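/- Let $J=\begin{pmatrix}0&-1\\1&0\end{pmatrix}$ and let $B(t)=S(p+qt)$, $t\in\mathbb R$, be quasi-periodic: $S:\mathbb T^m=(\mathbb R/\mathbb Z)^m\to \mathrm{Sym}(2,\mathbb R)$ is continuous, $p,q\in\mathbb R^m$, and $q_1,\dots,q_m$ are linearly independent over $\mathbb Q$. Let $\gamma$ be the fundamental solution of the planar linear Hamiltonian system $\dot z=JB(t)z$, that is, $\dot\gamma=JB\gamma$, $\gamma(0)=I$. *Index.* Co-orient the hypersurface $\mathrm{Sp}(2)^0_1=\{M\in\mathrm{Sp}(2,\mathbb R):\det(M-I)=0\}$ by the direction of the paths $s\mapsto Me^{sJ}$. The intersection number $[\alpha:\mathrm{Sp}(2)^0_1]$ of a continuous path $\alpha$ in $\mathrm{Sp}(2,\mathbb R)$ with end points off $\mathrm{Sp}(2)^0_1$ is the signed number of crossings of any path that is homotopic to $\alpha$ in $\mathrm{Sp}(2,\mathbb R)$ with fixed end points and that meets $\mathrm{Sp}(2)^0_1$ finitely often, each time transversally. The Maslov-type index is $i_1(\gamma,[0,l])=[e^{-\epsilon J}\gamma|_{[0,l]}:\mathrm{Sp}(2)^0_1]-1$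 for all sufficiently small $\epsilon>0$. The mean index is the interval $\mathcal I(B)=\left[\varliminf_{l\to+\infty} i_1(\gamma,[0,l])/l,\ \varlimsup_{l\to+\infty} i_1(\gamma,[0,l])/l\right]$. *Rotation number.* For a nonzero solution $z=(u,v)^T$ let $\theta:\mathbb R\to\mathbb R$ be a continuous function such that $\theta(t)$ is an argument of $u(t)+iv(t)$ for all $t$; put $R(B)=\lim_{t\to+\infty}\theta(t)/t$. **Theorem.** The index $i_1(\gamma,[0,l])$ is well defined for every $l>0$; $\mathcal I(B)$ is a single real number; the limit $R(B)$ exists and is the same for all nonzero solutions $z$ and all continuous arguments $\theta$; and $$\pi\,\mathcal I(B)=R(B).$$ -/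

import Mathlib

open Filter Topology Set

namespace HamiltonianMeanIndex

/-- Real `2n × 2n` matrices, in `n × n` blocks. -/
abbrev Mat (n : ℕ) : Type := Matrix (Fin n ⊕ Fin n) (Fin n ⊕ Fin n) ℝ

/-- The standard symplectic matrix with blocks `0, -I; I, 0`. -/
abbrev J (n : ℕ) : Mat n := Matrix.J (Fin n) ℝ

/-- The real symplectic group, as a set of matrices. -/
abbrev Sp (n : ℕ) : Set (Mat n) := {M | M ∈ Matrix.symplecticGroup (Fin n) ℝ}

/-- The matrix exponential `exp (s J) = cos s I + sin s J`. -/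
noncomputable def expJ (n : ℕ) (s : ℝ) : Mat n :=
  Real.cos s • (1 : Mat n) + Real.sin s • J n

theorem expJ_eq_exp (n : ℕ) (s : ℝ) : expJ n s = NormedSpace.exp (s • J n) := by
  let : NormedRing (Mat n) := Matrix.linftyOpNormedRing
  let : NormedAlgebra ℝ (Mat n) := Matrix.linftyOpNormedAlgebra
  let : NormedAlgebra ℚ (Mat n) := NormedAlgebra.restrictScalars ℚ ℝ (Mat n)
  have hJ : J n * J n = -1 := Matrix.J_squared (Fin n) ℝ
  let f : ℂ →ₐ[ℝ] Mat n := Complex.lift ⟨J n, hJ⟩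
  have hf : @Continuous _ _ _ inferInstance f := f.toLinearMap.continuous_of_finiteDimensional
  have h1 : ∀ x y : ℝ, f ((x : ℂ) + (y : ℂ) * Complex.I) = x • (1 : Mat n) + y • J n := by
    intro x y
    simp [f, Complex.liftAux_apply, Algebra.algebraMap_eq_smul_one]
  have h2 : f (NormedSpace.exp ((s : ℂ) * Complex.I)) = NormedSpace.exp (f ((s : ℂ) * Complex.I)) :=
    NormedSpace.map_exp (f := f.toRingHom) hf _
  have h3 := h1 0 s
  rw [Complex.ofReal_zero, zero_add, zero_smul, zero_add] at h3
  rw [h3, ← Complex.exp_eq_exp_ℂ, Complex.exp_mul_I, ← Complex.ofReal_cos, ← Complex.ofReal_sin,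
    h1] at h2
  exact h2

/-! ### Linear Hamiltonian systems -/

/-- `z` solves `z' = J B(t) z` on the whole real line. -/
def IsSolution {n : ℕ} (B : ℝ → Mat n) (z : ℝ → Fin n ⊕ Fin n → ℝ) : Prop :=
  ∀ t : ℝ, HasDerivAt z ((J n * B t).mulVec (z t)) t

/-- `γ' = J B(t) γ` on the whole real line (entrywise) and `γ(0) = I`. -/
def IsFundamentalSolution {n : ℕ} (B γ : ℝ → Mat n) : Prop :=
  γ 0 = 1 ∧ ∀ (t : ℝ) (i j : Fin n ⊕ Fin n),
    HasDerivAt (fun s => γ s i j) ((J n * B t * γ t) i j) t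

/-- `B(t) = S(p + q t)` with `S` a continuous map from the torus `(ℝ/ℤ)^m` to the symmetric
matrices and with `q₁, …, q_m` linearly independent over the rationals. -/
def IsQuasiPeriodic {n : ℕ} (B : ℝ → Mat n) : Prop :=
  ∃ (m : ℕ) (S : (Fin m → UnitAddCircle) → Mat n) (p q : Fin m → ℝ),
    Continuous S ∧ (∀ x, (S x).IsSymm) ∧ LinearIndependent ℚ q ∧
      ∀ t : ℝ, B t = S fun i => ((p i + q i * t : ℝ) : UnitAddCircle)

/-! ### Intersection number with the hypersurface `det (M - I) = 0` -/

/-- Homotopy with fixed end points, through continuous paths `[0, l] → Sp(2n)`. -/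
def SpHomotopic {n : ℕ} (l : ℝ) (α β : ℝ → Mat n) : Prop :=
  ∃ H : ℝ × ℝ → Mat n,
    ContinuousOn H (Icc 0 1 ×ˢ Icc 0 l) ∧
    (∀ s ∈ Icc (0 : ℝ) 1, ∀ t ∈ Icc 0 l, H (s, t) ∈ Sp n) ∧
    (∀ t ∈ Icc 0 l, H (0, t) = α t ∧ H (1, t) = β t) ∧
    ∀ s ∈ Icc (0 : ℝ) 1, H (s, 0) = α 0 ∧ H (s, l) = α l

/-- The function whose zero set in `Sp(2n)` is the hypersurface. -/
noncomputable def degen {n : ℕ} (M : Mat n) : ℝ := (M - 1).det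

/-- The path `β` meets the hypersurface transversally at time `t`: it is differentiable there and
`degen ∘ β` has nonzero derivative. Since `degen` has zero differential where
`dim ker (M - I) ≥ 2`, such a crossing lies in the regular part `dim ker (M - I) = 1`. -/
def IsTransverseAt {n : ℕ} (β : ℝ → Mat n) (t : ℝ) : Prop :=
  (∀ i j, DifferentiableAt ℝ (fun s => β s i j) t) ∧ deriv (fun s => degen (β s)) t ≠ 0

/-- The sign of a transversal crossing, relative to the co-orientation of the hypersurface at
`M = β t` for which `s ↦ M exp (s J)` crosses positively at `s = 0`: it is `1` if `β` goes to the
same side as that path, and `-1` otherwise. -/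
noncomputable def crossingSign {n : ℕ} (β : ℝ → Mat n) (t : ℝ) : ℤ :=
  (SignType.sign (deriv (fun s => degen (β s)) t) : ℤ) *
    (SignType.sign (deriv (fun s => degen (β t * expJ n s)) 0) : ℤ)

/-- `k` is the intersection number of the path `α : [0, l] → Sp(2n)`, whose end points are off the
hypersurface: `α` is homotopic, with fixed end points, to a path that meets the hypersurface
finitely often and always transversally, and `k` is the signed number of crossings of the latter. -/
def HasIntersectionNumber {n : ℕ} (l : ℝ) (α : ℝ → Mat n) (k : ℤ) : Prop :=
  degen (α 0) ≠ 0 ∧ degen (α l) ≠ 0 ∧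
    ∃ (β : ℝ → Mat n) (C : Finset ℝ), SpHomotopic l α β ∧
      (∀ t, t ∈ C ↔ t ∈ Icc 0 l ∧ degen (β t) = 0) ∧
      (∀ t ∈ C, IsTransverseAt β t) ∧
      k = ∑ t ∈ C, crossingSign β t

/-! ### The Maslov-type index and the mean index -/

/-- `k` is the Maslov-type index `i₁(γ, [0, l])` of a path in `Sp(2n)` with `γ(0) = I`: for all
small `ε > 0`, the intersection number of `exp (-ε J) γ` on `[0, l]` is `k + n`. -/
def HasMaslovIndex {n : ℕ} (γ : ℝ → Mat n) (l : ℝ) (k : ℤ) : Prop :=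
  ∀ᶠ ε in 𝓝[>] (0 : ℝ), HasIntersectionNumber l (fun t => expJ n (-ε) * γ t) (k + n)

open Classical in
/-- The Maslov-type index `i₁(γ, [0, l])` (with value `0` if there is none). -/
noncomputable def maslovIndex {n : ℕ} (γ : ℝ → Mat n) (l : ℝ) : ℤ :=
  if h : ∃ k, HasMaslovIndex γ l k then h.choose else 0

/-- The upper mean index, the upper limit of `i₁(γ, [0, l]) / l` as `l → +∞`. -/
noncomputable def upperMeanIndex {n : ℕ} (γ : ℝ → Mat n) : EReal :=
  limsup (fun l : ℝ => (((maslovIndex γ l : ℝ) / l : ℝ) : EReal)) atTop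

/-- The lower mean index, the lower limit of `i₁(γ, [0, l]) / l` as `l → +∞`. -/
noncomputable def lowerMeanIndex {n : ℕ} (γ : ℝ → Mat n) : EReal :=
  liminf (fun l : ℝ => (((maslovIndex γ l : ℝ) / l : ℝ) : EReal)) atTop

/-- The mean index set, the interval from the lower to the upper mean index. -/
noncomputable def meanIndex {n : ℕ} (γ : ℝ → Mat n) : Set ℝ :=
  {a : ℝ | lowerMeanIndex γ ≤ (a : EReal) ∧ (a : EReal) ≤ upperMeanIndex γ}

/-! ### The rotation number in dimension two -/

/-- `θ` is a continuous choice of the argument of `u + i v`, for the planar curve `z = (u, v)`. -/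
def IsArgument (z : ℝ → Fin 1 ⊕ Fin 1 → ℝ) (θ : ℝ → ℝ) : Prop :=
  Continuous θ ∧ ∀ t : ℝ,
    (θ t : Real.Angle) = (Complex.arg ⟨z t (Sum.inl 0), z t (Sum.inr 0)⟩ : Real.Angle)

/-- `θ(t) / t → R` as `t → +∞` for every continuous argument `θ` of every nonzero solution. -/
def IsRotationNumber (B : ℝ → Mat 1) (R : ℝ) : Prop :=
  ∀ (z : ℝ → Fin 1 ⊕ Fin 1 → ℝ) (θ : ℝ → ℝ), IsSolution B z → z ≠ 0 → IsArgument z θ →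
    Tendsto (fun t => θ t / t) atTop (𝓝 R)

end HamiltonianMeanIndex

/-! Identify the plane with `ℂ`, so that a real `2 × 2` matrix acts as `ζ ↦ (w ζ + z ζ̄) / 2`. It is
symplectic iff `|w|² - |z|² = 4`. Hence `|w| ≥ 2`, and along `γ` the number `w` has a continuous
argument `φ` with `φ(0) = 0`. Both the index and the rotation of solutions stay within a bounded
distance of `φ`, up to the factor `π`, so they have the same growth rate once one of them is known
to have one.

Index. On `Sp(2)` one has `det (M - I) = 2 - Re w`, and `M ↦ M exp(sJ)` multiplies `w` by `exp(is)`.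
The pair `(φ, z)` is a global coordinate on the universal cover. There the complement of the
hypersurface falls into regions numbered consecutively by `phaseIndex`: even numbers where `Re w >
2`, odd ones where `Re w < 2`. A transversal crossing changes the number by its sign
(`IsPhase.phaseIndex_jump`), so lifting a homotopy makes the intersection number a difference of end
point values (`HasIntersectionNumber.eq_phaseIndex_sub`). A transversal representative exists by a
Sard argument (`exists_hasIntersectionNumber`). Since `π * phaseIndex` differs from the argument by
at most `π`, `π i₁` stays close to `φ`.

Rotation. A solution is `ζ = (w ζ(0) + z conj ζ(0)) / 2` with `|z| < |w|`, so its argument, up to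
the initial value, stays within `π / 2` of `φ` (`IsPropagator.abs_phase_sub_lt`). The coefficients
are almost periodic; by Gronwall, translation by a suitable almost period changes the rotation over
a window of length `T` by at most `3π / 2`, whatever `T` is (`exists_abs_rotation_sub_le`). Per unit
of time this error is `O(1 / T)`, so the mean rotation converges (`exists_tendsto_div`). -/

namespace HamiltonianMeanIndex

/-! ### Continuous arguments of nonvanishing complex functions -/

open Complex in
/-- `φ` is a continuous argument of the function `w`. -/
def IsPhase {X : Type*} [TopologicalSpace X] (w : X → ℂ) (φ : X → ℝ) : Prop :=
  Continuous φ ∧ ∀ x, w x = ‖w x‖ * exp (φ x * I)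

open Complex in
-- Lift `w` through the covering `exp : ℂ → ℂ \ {0}`; the imaginary part of the lift is the
-- argument. Besides `ℝ`, the case of the plane is needed, for lifting homotopies.
theorem exists_phase {X : Type*} [TopologicalSpace X] [SimplyConnectedSpace X]
    [LocallyPathConnectedSpace X] {w : X → ℂ} (hw : Continuous w) (h0 : ∀ x, w x ≠ 0)
    (x₀ : X) {φ₀ : ℝ} (hφ₀ : w x₀ = ‖w x₀‖ * exp (φ₀ * I)) :
    ∃ φ, IsPhase w φ ∧ φ x₀ = φ₀ := by
  obtain ⟨F, ⟨hF0, hF⟩, -⟩ := Complex.isCoveringMap_exp.existsUnique_continuousMap_lifts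
    (⟨fun x => ⟨w x, h0 x⟩, by fun_prop⟩ : C(X, {z : ℂ // z ≠ 0})) x₀
    ((Real.log ‖w x₀‖ : ℂ) + φ₀ * I) (by
      apply Subtype.ext
      simp only [ContinuousMap.coe_mk]
      rw [Complex.exp_add, ← Complex.ofReal_exp, Real.exp_log (norm_pos_iff.2 (h0 x₀)), ← hφ₀])
  have hF' : ∀ x, exp (F x) = w x := fun x => congrArg Subtype.val (congrFun hF x)
  refine ⟨fun x => (F x).im, ⟨by fun_prop, fun x => ?_⟩, ?_⟩
  · rw [← hF' x, Complex.norm_exp, Complex.ofReal_exp, ← Complex.exp_add, Complex.re_add_im]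
  · simp [hF0]

/-- Expanding the squared hypothesis gives `|w₂|² < 2 |w₁| |w₂| cos (a - b)`. -/
theorem cos_sub_pos_of_norm_sub_lt {w₁ w₂ : ℂ} {a b : ℝ} (h : ‖w₁ - w₂‖ < ‖w₁‖)
    (h₁ : w₁ = ‖w₁‖ * Complex.exp (a * Complex.I)) (h₂ : w₂ = ‖w₂‖ * Complex.exp (b * Complex.I)) :
    0 < Real.cos (a - b) := by
  have e₁ : w₁.re = ‖w₁‖ * Real.cos a ∧ w₁.im = ‖w₁‖ * Real.sin a := by
    constructor
    · conv_lhs => rw [h₁]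
      rw [Complex.re_ofReal_mul, Complex.exp_ofReal_mul_I_re]
    · conv_lhs => rw [h₁]
      rw [Complex.im_ofReal_mul, Complex.exp_ofReal_mul_I_im]
  have e₂ : w₂.re = ‖w₂‖ * Real.cos b ∧ w₂.im = ‖w₂‖ * Real.sin b := by
    constructor
    · conv_lhs => rw [h₂]
      rw [Complex.re_ofReal_mul, Complex.exp_ofReal_mul_I_re]
    · conv_lhs => rw [h₂]
      rw [Complex.im_ofReal_mul, Complex.exp_ofReal_mul_I_im]
  have hsq : ‖w₁ - w₂‖ ^ 2 < ‖w₁‖ ^ 2 := by gcongr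
  rw [← Complex.normSq_eq_norm_sq (w₁ - w₂), Complex.normSq_apply, Complex.sub_re, Complex.sub_im,
    e₁.1, e₁.2, e₂.1, e₂.2] at hsq
  have hp : 0 < ‖w₁‖ * ‖w₂‖ * Real.cos (a - b) := by
    rw [Real.cos_sub]
    nlinarith [Real.sin_sq_add_cos_sq a, Real.sin_sq_add_cos_sq b, sq_nonneg ‖w₂‖]
  exact pos_of_mul_pos_right hp (by positivity)

/-- Two continuous arguments that start together stay within `π / 2` of each other as long as the
curves stay close relative to their norms. -/
theorem phase_close {w₁ w₂ : ℝ → ℂ} {φ₁ φ₂ : ℝ → ℝ} (h₁ : IsPhase w₁ φ₁) (h₂ : IsPhase w₂ φ₂)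
    (h0 : φ₁ 0 = φ₂ 0) {t : ℝ} (ht : 0 ≤ t) (h : ∀ s ∈ Icc 0 t, ‖w₁ s - w₂ s‖ < ‖w₁ s‖) :
    |φ₁ t - φ₂ t| < Real.pi / 2 := by
  by_contra! hcon
  have hc : ContinuousOn (fun s => |φ₁ s - φ₂ s|) (Icc 0 t) :=
    (h₁.1.sub h₂.1).abs.continuousOn
  -- The difference starts at `0`; to exceed `π / 2` it would have to equal it at some time, where
  -- the cosine would vanish.
  obtain ⟨s, hs, hs'⟩ := intermediate_value_Icc ht hc
    (show Real.pi / 2 ∈ Icc _ _ from ⟨by simp [h0]; positivity, hcon⟩)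
  have := cos_sub_pos_of_norm_sub_lt (h s hs) (h₁.2 s) (h₂.2 s)
  simp only at hs'
  rw [← Real.cos_abs, hs', Real.cos_pi_div_two] at this
  exact lt_irrefl _ this

theorem eq_of_exp_eq_of_abs_sub_lt {a b : ℝ}
    (h : Complex.exp (a * Complex.I) = Complex.exp (b * Complex.I)) (hab : |a - b| < Real.pi) :
    a = b := by
  rw [Complex.exp_eq_exp_iff_exists_int] at h
  obtain ⟨n, hn⟩ := h
  have h1 : a = b + n * (2 * Real.pi) := by
    have := congrArg Complex.im hn
    simpa using this
  have hpi := Real.pi_pos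
  have : n = 0 := by
    rw [h1, add_sub_cancel_left, abs_mul, abs_of_pos (by positivity : 0 < 2 * Real.pi)] at hab
    have h2 : |(n : ℝ)| < 1 := by nlinarith [abs_nonneg (n : ℝ)]
    exact Int.abs_lt_one_iff.1 (by exact_mod_cast h2)
  rw [h1, this]; simp

theorem phase_unique {w : ℝ → ℂ} {φ₁ φ₂ : ℝ → ℝ} (h₁ : IsPhase w φ₁) (h₂ : IsPhase w φ₂)
    (h0 : φ₁ 0 = φ₂ 0) (hw : ∀ t, w t ≠ 0) {t : ℝ} (ht : 0 ≤ t) : φ₁ t = φ₂ t := by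
  have hc := phase_close h₁ h₂ h0 ht (fun s _ => by simpa using hw s)
  refine eq_of_exp_eq_of_abs_sub_lt ?_ (hc.trans (by linarith [Real.pi_pos]))
  have h := (h₁.2 t).symm.trans (h₂.2 t)
  exact mul_left_cancel₀ (by simpa using hw t) h

end HamiltonianMeanIndex

/-! ### The planar system in complex coordinates -/

namespace HamiltonianMeanIndex

open Complex ComplexConjugate

/-- The planar system `ζ' = i (b₀ ζ + b₁ ζ̄)`, for the pair `(w, z)` that represents the real linear
map `ζ ↦ (w ζ + z ζ̄) / 2`. A single solution is the pair `(ζ, ζ)`. -/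
def IsPairSolution (b₀ : ℝ → ℝ) (b₁ : ℝ → ℂ) (w z : ℝ → ℂ) : Prop :=
  ∀ t, HasDerivAt w (I * (b₀ t * w t + b₁ t * conj (z t))) t ∧
    HasDerivAt z (I * (b₀ t * z t + b₁ t * conj (w t))) t

/-- The fundamental solution of the system in complex coordinates. -/
structure IsPropagator (b₀ : ℝ → ℝ) (b₁ : ℝ → ℂ) (w z : ℝ → ℂ) : Prop where
  pair : IsPairSolution b₀ b₁ w z
  fst_zero : w 0 = 2
  snd_zero : z 0 = 0

variable {b₀ : ℝ → ℝ} {b₁ w z ζ : ℝ → ℂ}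

theorem hasDerivAt_conj {f : ℝ → ℂ} {f' : ℂ} {t : ℝ} (h : HasDerivAt f f' t) :
    HasDerivAt (fun t => conj (f t)) (conj f') t := h.star

theorem eq_of_hasDerivAt_zero {f : ℝ → ℂ} (h : ∀ t, HasDerivAt f 0 t) (t : ℝ) : f t = f 0 :=
  is_const_of_deriv_eq_zero (fun x => (h x).differentiableAt) (fun x => (h x).deriv) t 0

/-- Conservation of the determinant, which is `(|w|² - |z|²) / 4`. -/
theorem IsPropagator.normSq_sub (h : IsPropagator b₀ b₁ w z) (t : ℝ) :
    w t * conj (w t) - z t * conj (z t) = 4 := by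
  have hd : ∀ t, HasDerivAt (fun t => w t * conj (w t) - z t * conj (z t)) 0 t := by
    intro t
    obtain ⟨h1, h2⟩ := h.pair t
    refine ((h1.mul (hasDerivAt_conj h1)).sub (h2.mul (hasDerivAt_conj h2))).congr_deriv ?_
    simp only [map_mul, map_add, conj_I, conj_ofReal, conj_conj]
    ring
  rw [eq_of_hasDerivAt_zero hd t, h.fst_zero, h.snd_zero]
  norm_num [Complex.conj_ofNat]

theorem IsPropagator.norm_sq_sub (h : IsPropagator b₀ b₁ w z) (t : ℝ) :
    ‖w t‖ ^ 2 - ‖z t‖ ^ 2 = 4 := by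
  have := h.normSq_sub t
  rw [mul_conj, mul_conj, normSq_eq_norm_sq, normSq_eq_norm_sq] at this
  exact_mod_cast this

theorem IsPropagator.norm_snd_lt (h : IsPropagator b₀ b₁ w z) (t : ℝ) : ‖z t‖ < ‖w t‖ := by
  nlinarith [h.norm_sq_sub t, norm_nonneg (z t), norm_nonneg (w t)]

theorem IsPropagator.two_le_norm (h : IsPropagator b₀ b₁ w z) (t : ℝ) : 2 ≤ ‖w t‖ := by
  nlinarith [h.norm_sq_sub t, sq_nonneg ‖z t‖, norm_nonneg (w t)]

theorem IsPropagator.fst_ne_zero (h : IsPropagator b₀ b₁ w z) (t : ℝ) : w t ≠ 0 :=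
  norm_pos_iff.1 (by linarith [h.two_le_norm t])

theorem IsPropagator.continuous_fst (h : IsPropagator b₀ b₁ w z) : Continuous w :=
  continuous_iff_continuousAt.2 fun t => (h.pair t).1.continuousAt

/-- The inverse of the propagator has parts `(w̄, -z)`. Applied to a solution it gives the conserved
quantity `w̄ ζ - z ζ̄ = 2 ζ(0)`, and solving for `ζ` gives the formula, so uniqueness for the
differential equation is not invoked. -/
theorem IsPropagator.solution_eq (h : IsPropagator b₀ b₁ w z) (hζ : IsPairSolution b₀ b₁ ζ ζ)
    (t : ℝ) : ζ t = (w t * ζ 0 + z t * conj (ζ 0)) / 2 := by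
  have hd : ∀ t, HasDerivAt (fun t => conj (w t) * ζ t - z t * conj (ζ t)) 0 t := by
    intro t
    obtain ⟨h1, h2⟩ := h.pair t
    have h3 := (hζ t).1
    refine (((hasDerivAt_conj h1).mul h3).sub (h2.mul (hasDerivAt_conj h3))).congr_deriv ?_
    simp only [map_mul, map_add, conj_I, conj_ofReal, conj_conj]
    ring
  have h1 := eq_of_hasDerivAt_zero hd t
  have h2 := h.normSq_sub t
  have h3 := congrArg conj h1
  simp only [h.fst_zero, h.snd_zero, map_sub, map_mul, conj_conj, Complex.conj_ofNat,
    zero_mul, sub_zero] at h1 h3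
  linear_combination (-ζ t / 4) * h2 + w t / 4 * h1 + z t / 4 * h3

/-- The pair displayed consists of the parts of `γ(s + t) γ(s)⁻¹`. -/
theorem IsPropagator.shift (h : IsPropagator b₀ b₁ w z) (s : ℝ) :
    IsPropagator (fun t => b₀ (s + t)) (fun t => b₁ (s + t))
      (fun t => (w (s + t) * conj (w s) - z (s + t) * conj (z s)) / 2)
      (fun t => (z (s + t) * w s - w (s + t) * z s) / 2) := by
  refine ⟨fun t => ?_, ?_, ?_⟩
  · obtain ⟨h1, h2⟩ := h.pair (s + t)
    have h1' := h1.comp_const_add s t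
    have h2' := h2.comp_const_add s t
    constructor
    · refine (((h1'.mul_const (conj (w s))).sub (h2'.mul_const (conj (z s)))).div_const
        2).congr_deriv ?_
      simp only [map_sub, map_mul, map_div₀, Complex.conj_ofNat]
      ring
    · refine (((h2'.mul_const (w s)).sub (h1'.mul_const (z s))).div_const 2).congr_deriv ?_
      simp only [map_sub, map_mul, map_div₀, Complex.conj_ofNat, conj_conj]
      ring
  · simp only [add_zero]
    rw [h.normSq_sub s]; norm_num
  · simp only [add_zero]; ring

theorem IsPairSolution.shift (h : IsPairSolution b₀ b₁ w z) (s : ℝ) :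
    IsPairSolution (fun t => b₀ (s + t)) (fun t => b₁ (s + t)) (fun t => w (s + t))
      (fun t => z (s + t)) := fun t =>
  ⟨(h (s + t)).1.comp_const_add s t, (h (s + t)).2.comp_const_add s t⟩

theorem IsPropagator.solution_ne_zero (h : IsPropagator b₀ b₁ w z)
    (hζ : IsPairSolution b₀ b₁ ζ ζ) (h0 : ζ 0 ≠ 0) (t : ℝ) : ζ t ≠ 0 := by
  intro ht
  have h1 := (h.shift t).solution_eq (hζ.shift t) (-t)
  simp [ht] at h1
  exact h0 h1

theorem IsPhase.shift {w : ℝ → ℂ} {φ : ℝ → ℝ} (h : IsPhase w φ) (s : ℝ) :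
    IsPhase (fun t => w (s + t)) (fun t => φ (s + t)) :=
  ⟨h.1.comp (by fun_prop), fun t => h.2 (s + t)⟩

/-- The argument of a solution follows the argument of the first component of the propagator. -/
theorem IsPropagator.abs_phase_sub_lt (h : IsPropagator b₀ b₁ w z)
    (hζ : IsPairSolution b₀ b₁ ζ ζ) (h0 : ζ 0 ≠ 0) {φ θ : ℝ → ℝ} (hφ : IsPhase w φ)
    (hφ0 : φ 0 = 0) (hθ : IsPhase ζ θ) {t : ℝ} (ht : 0 ≤ t) :
    |φ t - (θ t - θ 0)| < Real.pi / 2 := by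
  have h1 : IsPhase (fun t => w t * ζ 0 / 2) (fun t => φ t + θ 0) := by
    refine ⟨hφ.1.add continuous_const, fun t => ?_⟩
    simp only [norm_div, norm_mul]
    conv_lhs => rw [hφ.2 t, hθ.2 0]
    push_cast
    rw [add_mul, Complex.exp_add]
    simp
    ring
  -- The curve `w ζ(0) / 2` differs from `ζ` by `z conj ζ(0) / 2`, which is shorter than it because
  -- `|z| < |w|`.
  have := phase_close h1 hθ (by simp [hφ0]) ht (fun s _ => by
    have e : w s * ζ 0 / 2 - ζ s = - (z s * conj (ζ 0) / 2) := by
      rw [h.solution_eq hζ s]; ring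
    rw [e, norm_neg, norm_div, norm_div, norm_mul, norm_mul, RCLike.norm_conj]
    have := h.norm_snd_lt s
    have := norm_pos_iff.2 h0
    gcongr
    simp)
  rwa [show φ t + θ 0 - θ t = φ t - (θ t - θ 0) by ring] at this

/-- The logarithmic derivative `ζ' / ζ` is bounded by `C`; the imaginary part of its integral is the
argument up to a constant. -/
theorem IsPairSolution.exists_lipschitz_phase (hζ : IsPairSolution b₀ b₁ ζ ζ)
    (h0 : ∀ t, ζ t ≠ 0) (hb₀ : Continuous b₀) (hb₁ : Continuous b₁) {C : ℝ}
    (hC : ∀ t, |b₀ t| + ‖b₁ t‖ ≤ C) :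
    ∃ θ, IsPhase ζ θ ∧ ∀ x y, |θ x - θ y| ≤ C * |x - y| := by
  have hc : Continuous ζ := continuous_iff_continuousAt.2 fun t => (hζ t).1.continuousAt
  set g : ℝ → ℂ := fun t => I * (b₀ t * ζ t + b₁ t * conj (ζ t)) / ζ t with hg
  have hgc : Continuous g := by
    refine Continuous.div ?_ hc h0
    fun_prop
  have hgC : ∀ t, ‖g t‖ ≤ C := by
    intro t
    rw [hg]
    simp only [norm_div, norm_mul, norm_I, one_mul]
    rw [div_le_iff₀ (norm_pos_iff.2 (h0 t))]
    refine (norm_add_le _ _).trans ?_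
    rw [norm_mul, norm_mul, RCLike.norm_conj, ← add_mul, Complex.norm_real, Real.norm_eq_abs]
    exact mul_le_mul_of_nonneg_right (hC t) (norm_nonneg _)
  set L : ℝ → ℂ := fun t => ∫ s in (0 : ℝ)..t, g s with hL
  have hLd : ∀ t, HasDerivAt L (g t) t := fun t =>
    intervalIntegral.integral_hasDerivAt_right (hgc.intervalIntegrable _ _)
      (hgc.stronglyMeasurableAtFilter _ _) hgc.continuousAt
  have hLc : Continuous L := continuous_iff_continuousAt.2 fun t => (hLd t).continuousAt
  have hd : ∀ t, HasDerivAt (fun t => ζ t * exp (-L t)) 0 t := by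
    intro t
    refine ((hζ t).1.mul (hLd t).neg.cexp).congr_deriv ?_
    rw [hg]
    field_simp [h0 t]
    ring
  have hL0 : L 0 = 0 := by simp [hL]
  have hζL : ∀ t, ζ t = ζ 0 * exp (L t) := by
    intro t
    have := eq_of_hasDerivAt_zero hd t
    simp only [hL0, neg_zero, Complex.exp_zero, mul_one] at this
    rw [← this, mul_assoc, ← Complex.exp_add]
    simp
  refine ⟨fun t => arg (ζ 0) + (L t).im, ⟨by fun_prop, fun t => ?_⟩, fun x y => ?_⟩
  · have e1 : ‖ζ t‖ = ‖ζ 0‖ * Real.exp (L t).re := by rw [hζL t, norm_mul, Complex.norm_exp]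
    rw [e1]
    conv_lhs => rw [hζL t, ← Complex.norm_mul_exp_arg_mul_I (ζ 0), ← Complex.re_add_im (L t)]
    push_cast
    rw [add_mul, Complex.exp_add, Complex.exp_add]
    ring
  · have : arg (ζ 0) + (L x).im - (arg (ζ 0) + (L y).im) = (∫ s in y..x, g s).im := by
      rw [← intervalIntegral.integral_interval_sub_left (hgc.intervalIntegrable 0 x)
        (hgc.intervalIntegrable 0 y)]
      simp [hL]
    rw [this]
    exact (Complex.abs_im_le_norm _).trans
      (intervalIntegral.norm_integral_le_of_norm_le_const fun s _ => hgC s)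

/-- The right-hand side of the system for the pair `(w, z)`. -/
noncomputable def pairField (b : ℝ) (c : ℂ) (p : ℂ × ℂ) : ℂ × ℂ :=
  (I * (b * p.1 + c * conj p.2), I * (b * p.2 + c * conj p.1))

theorem norm_pairField_le (b : ℝ) (c : ℂ) (p : ℂ × ℂ) :
    ‖pairField b c p‖ ≤ (|b| + ‖c‖) * ‖p‖ := by
  have key : ∀ u v : ℂ, ‖u‖ ≤ ‖p‖ → ‖v‖ ≤ ‖p‖ →
      ‖I * (b * u + c * conj v)‖ ≤ (|b| + ‖c‖) * ‖p‖ := by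
    intro u v hu hv
    rw [norm_mul, norm_I, one_mul, add_mul]
    refine (norm_add_le _ _).trans ?_
    rw [norm_mul, norm_mul, RCLike.norm_conj, Complex.norm_real, Real.norm_eq_abs]
    gcongr
  exact max_le (key _ _ (norm_fst_le p) (norm_snd_le p)) (key _ _ (norm_snd_le p) (norm_fst_le p))

theorem IsPairSolution.hasDerivAt_prod (h : IsPairSolution b₀ b₁ w z) (t : ℝ) :
    HasDerivAt (fun t => (w t, z t)) (pairField (b₀ t) (b₁ t) (w t, z t)) t :=
  (h t).1.prodMk (h t).2

/-- Propagators of nearby systems are close on a bounded time interval. -/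
theorem exists_norm_propagator_sub_le {C : ℝ} (hC : 0 < C) (T : ℝ) :
    ∃ ε > 0, ∀ {b₀ b₀' : ℝ → ℝ} {b₁ b₁' w z w' z' : ℝ → ℂ},
      IsPropagator b₀ b₁ w z → IsPropagator b₀' b₁' w' z' →
      (∀ t, |b₀ t| + ‖b₁ t‖ ≤ C) → (∀ t, |b₀' t| + ‖b₁' t‖ ≤ C) →
      (∀ t, |b₀ t - b₀' t| + ‖b₁ t - b₁' t‖ ≤ ε) → ∀ t ∈ Icc 0 T, ‖w t - w' t‖ ≤ 1 := by
  -- Gronwall bounds the second propagator by `2 exp(CT)` and then the difference by `ε * 2 exp(CT)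
  -- * (exp(CT) - 1) / C`. This `ε` makes the latter less than `1`, hence less than `|w| ≥ 2`.
  refine ⟨C / (2 * Real.exp (C * T) * Real.exp (C * T)), by positivity, ?_⟩
  intro b₀ b₀' b₁ b₁' w z w' z' h h' hb hb' hbb t ht
  set ε := C / (2 * Real.exp (C * T) * Real.exp (C * T)) with hε
  have hε0 : 0 < ε := by positivity
  have hT : ∀ s ∈ Icc 0 T, ‖(w' s, z' s)‖ ≤ 2 * Real.exp (C * T) := by
    intro s hs
    have := norm_le_gronwallBound_of_norm_deriv_right_le (f := fun t => (w' t, z' t))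
      (δ := 2) (K := C) (ε := 0) (a := 0) (b := T)
      (fun x _ => (h'.pair.hasDerivAt_prod x).continuousAt.continuousWithinAt)
      (fun x _ => (h'.pair.hasDerivAt_prod x).hasDerivWithinAt)
      (by simp [h'.fst_zero, h'.snd_zero, Prod.norm_def])
      (fun x _ => by
        rw [add_zero]
        exact (norm_pairField_le _ _ _).trans
          (mul_le_mul_of_nonneg_right (hb' x) (norm_nonneg _))) s hs
    refine this.trans ?_
    rw [gronwallBound_ε0, sub_zero]
    have := hs.2
    gcongr
  have hd : ∀ x, HasDerivAt (fun t => (w t, z t) - (w' t, z' t))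
      (pairField (b₀ x) (b₁ x) (w x, z x) - pairField (b₀' x) (b₁' x) (w' x, z' x)) x :=
    fun x => (h.pair.hasDerivAt_prod x).sub (h'.pair.hasDerivAt_prod x)
  have hfin := norm_le_gronwallBound_of_norm_deriv_right_le
      (f := fun t => (w t, z t) - (w' t, z' t))
      (δ := 0) (K := C) (ε := ε * (2 * Real.exp (C * T))) (a := 0) (b := T)
      (fun x _ => (hd x).continuousAt.continuousWithinAt)
      (fun x _ => (hd x).hasDerivWithinAt)
      (by simp [h.fst_zero, h'.fst_zero, h.snd_zero, h'.snd_zero])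
      (fun x hx => by
        have e : pairField (b₀ x) (b₁ x) (w x, z x) - pairField (b₀' x) (b₁' x) (w' x, z' x) =
            pairField (b₀ x) (b₁ x) ((w x, z x) - (w' x, z' x)) +
              pairField (b₀ x - b₀' x) (b₁ x - b₁' x) (w' x, z' x) := by
          ext <;> simp [pairField] <;> ring
        rw [e]
        refine (norm_add_le _ _).trans (add_le_add ?_ ?_)
        · exact (norm_pairField_le _ _ _).trans
            (mul_le_mul_of_nonneg_right (hb x) (norm_nonneg _))
        · exact (norm_pairField_le _ _ _).trans
            (mul_le_mul (hbb x) (hT x ⟨hx.1, hx.2.le⟩) (norm_nonneg _) hε0.le)) t ht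
  have h1 : ‖w t - w' t‖ ≤ ‖(w t, z t) - (w' t, z' t)‖ := norm_fst_le ((w t, z t) - (w' t, z' t))
  refine h1.trans (hfin.trans ?_)
  rw [gronwallBound_of_K_ne_0 hC.ne', hε]
  simp only [zero_mul, zero_add, sub_zero]
  have h2 : Real.exp (C * t) ≤ Real.exp (C * T) := by
    have := ht.2
    gcongr
  have h3 := Real.exp_pos (C * T)
  field_simp
  linarith

/-- Shifting time by an almost period of the system changes the rotation of a solution over a
window of fixed length by at most a universal constant. -/
theorem exists_abs_rotation_sub_le {C : ℝ} (hC : 0 < C) {T : ℝ} (hT : 0 ≤ T) :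
    ∃ ε > 0, ∀ {b₀ : ℝ → ℝ} {b₁ w z ζ : ℝ → ℂ} {θ : ℝ → ℝ},
      IsPropagator b₀ b₁ w z → (∀ t, |b₀ t| + ‖b₁ t‖ ≤ C) → IsPairSolution b₀ b₁ ζ ζ →
      ζ 0 ≠ 0 → IsPhase ζ θ → ∀ τ, (∀ t, |b₀ (t + τ) - b₀ t| + ‖b₁ (t + τ) - b₁ t‖ ≤ ε) →
      ∀ s, |(θ (s + τ + T) - θ (s + τ)) - (θ (s + T) - θ s)| ≤ 3 * Real.pi / 2 := by
  obtain ⟨ε, hε, H⟩ := exists_norm_propagator_sub_le hC T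
  refine ⟨ε, hε, ?_⟩
  intro b₀ b₁ w z ζ θ hp hb hζ h0 hθ τ hτ s
  have phase : ∀ s, ∃ φ, IsPhase (fun t => (w (s + t) * conj (w s) - z (s + t) * conj (z s)) / 2) φ ∧
      φ 0 = 0 := by
    intro s
    refine exists_phase ?_ (hp.shift s).fst_ne_zero 0 ?_
    · exact (hp.shift s).continuous_fst
    · rw [(hp.shift s).fst_zero]; simp
  have close : ∀ s φ, IsPhase (fun t => (w (s + t) * conj (w s) - z (s + t) * conj (z s)) / 2) φ →
      φ 0 = 0 → |φ T - (θ (s + T) - θ s)| < Real.pi / 2 := by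
    intro s φ hφ hφ0
    have := (hp.shift s).abs_phase_sub_lt (hζ.shift s)
      (by simpa using hp.solution_ne_zero hζ h0 s) hφ hφ0 (hθ.shift s) hT
    simpa using this
  obtain ⟨φ₁, h1, h10⟩ := phase s
  obtain ⟨φ₂, h2, h20⟩ := phase (s + τ)
  -- Three errors of `π / 2` add up: solution against propagator on each of the two windows, and one
  -- propagator against the other.
  have c1 := close s φ₁ h1 h10
  have c2 := close (s + τ) φ₂ h2 h20
  have c3 := phase_close h1 h2 (h10.trans h20.symm) hT (fun t ht => by
    refine lt_of_le_of_lt (H (hp.shift s) (hp.shift (s + τ)) (fun t => hb _) (fun t => hb _)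
      (fun t => ?_) t ht) (by linarith [(hp.shift s).two_le_norm t])
    have := hτ (s + t)
    rw [show s + t + τ = s + τ + t by ring] at this
    rwa [abs_sub_comm, norm_sub_rev])
  rw [abs_lt] at c1 c2 c3
  rw [abs_le]
  constructor <;> linarith [c1.1, c1.2, c2.1, c2.2, c3.1, c3.2]

end HamiltonianMeanIndex

/-! ### Mean slope from almost periods -/

namespace HamiltonianMeanIndex

section Rotation

variable {θ : ℝ → ℝ} {C K : ℝ}

theorem abs_sub_mul_le_of_step {f : ℝ → ℝ} {D L c : ℝ} (h : ∀ n : ℕ, |f ((n + 1) * L) - f (n * L) - c| ≤ D)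
    (n : ℕ) : |f (n * L) - f 0 - n * c| ≤ n * D := by
  induction n with
  | zero => simp
  | succ n ih =>
    have h1 := h n
    push_cast
    rw [abs_le] at *
    constructor <;> nlinarith [h1.1, h1.2, ih.1, ih.2]

theorem natFloor_div_mul_le {x L : ℝ} (hx : 0 ≤ x) (hL : 0 < L) :
    (⌊x / L⌋₊ : ℝ) * L ≤ x ∧ x < ⌊x / L⌋₊ * L + L := by
  have h1 := Nat.floor_le (div_nonneg hx hL.le)
  have h2 := Nat.lt_floor_add_one (x / L)
  rw [le_div_iff₀ hL] at h1
  rw [div_lt_iff₀ hL] at h2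
  exact ⟨h1, by linarith⟩

/-- Replace `a` by an almost period `τ` near it and cut the window into pieces of length `T`, each
costing `K`. The rate `K / T` is small for large `T`; the Lipschitz bound puts the replacement of
`a` and the leftover piece into the constant `E`. -/
theorem exists_abs_increment_sub_le (hC : ∀ x y, |θ x - θ y| ≤ C * |x - y|) {T : ℝ} (hT : 0 < T)
    (h : ∃ l, ∀ a, ∃ τ, |τ - a| ≤ l ∧
      ∀ s, |(θ (s + τ + T) - θ (s + τ)) - (θ (s + T) - θ s)| ≤ K) :
    ∃ E, ∀ a L, 0 ≤ L → |(θ (a + L) - θ a) - (θ L - θ 0)| ≤ K / T * L + E := by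
  obtain ⟨l, hl⟩ := h
  have hC0 : 0 ≤ C := by simpa using (abs_nonneg _).trans (hC 1 0)
  refine ⟨C * l + C * (l + T) + C * T, fun a L hL => ?_⟩
  obtain ⟨τ, hτ, H⟩ := hl a
  have hK : 0 ≤ K := (abs_nonneg _).trans (H 0)
  set n := ⌊L / T⌋₊
  obtain ⟨n1, n2⟩ := natFloor_div_mul_le hL hT
  have e1 := abs_sub_mul_le_of_step (f := fun x => θ (x + τ) - θ x) (D := K) (L := T) (c := 0)
    (fun n => by
      have := H (n * T)
      convert this using 2
      rw [show n * T + τ + T = (n + 1) * T + τ by ring, show n * T + T = (n + 1) * T by ring]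
      ring) n
  have e2 := hC a τ
  have e3 : |θ (a + L) - θ (n * T + τ)| ≤ C * (l + T) := by
    refine (hC _ _).trans (mul_le_mul_of_nonneg_left ?_ hC0)
    rw [abs_le] at hτ ⊢
    constructor <;> linarith [hτ.1, hτ.2]
  have e4 : |θ L - θ (n * T)| ≤ C * T := by
    refine (hC _ _).trans (mul_le_mul_of_nonneg_left ?_ hC0)
    rw [abs_le]
    constructor <;> linarith
  have e5 : (n : ℝ) * K ≤ K / T * L := by
    rw [div_mul_eq_mul_div, le_div_iff₀ hT]
    nlinarith
  have e6 : |θ a - θ τ| ≤ C * l := by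
    refine e2.trans (mul_le_mul_of_nonneg_left ?_ hC0)
    rwa [abs_sub_comm]
  simp only [zero_add, mul_zero, sub_zero] at e1
  rw [abs_le] at e1 e3 e4 e6 ⊢
  constructor <;> linarith [e1.1, e1.2, e3.1, e3.2, e4.1, e4.2, e6.1, e6.2]

/-- Cut `[0, x]` into windows of length `L` and compare each with the one at the origin. -/
theorem abs_div_sub_div_le (hC : ∀ x y, |θ x - θ y| ≤ C * |x - y|) {δ E : ℝ} (hδ : 0 ≤ δ)
    (hE : 0 ≤ E) (h : ∀ a L, 0 ≤ L → |(θ (a + L) - θ a) - (θ L - θ 0)| ≤ δ * L + E)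
    {L x : ℝ} (hL : 0 < L) (hx : 0 < x) :
    |θ x / x - (θ L - θ 0) / L| ≤ δ + E / L + (2 * (C * L) + |θ 0|) / x := by
  have hC0 : 0 ≤ C := by simpa using (abs_nonneg _).trans (hC 1 0)
  set m := ⌊x / L⌋₊
  obtain ⟨m1, m2⟩ := natFloor_div_mul_le hx.le hL
  have e1 := abs_sub_mul_le_of_step (f := θ) (D := δ * L + E) (L := L) (c := θ L - θ 0)
    (fun n => by
      have := h (n * L) L hL.le
      rwa [show n * L + L = (n + 1) * L by ring] at this) m
  have e2 : |θ x - θ (m * L)| ≤ C * L := by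
    refine (hC _ _).trans (mul_le_mul_of_nonneg_left ?_ hC0)
    rw [abs_le]
    constructor <;> linarith
  have e3 : |θ L - θ 0| ≤ C * L := by simpa [abs_of_pos hL] using hC L 0
  have hm1 : (m : ℝ) ≤ x / L := by rwa [le_div_iff₀ hL]
  have hm2 : x / L ≤ m + 1 := by rw [div_le_iff₀ hL]; linarith
  have e4 : |(x / L - m) * (θ L - θ 0)| ≤ C * L := by
    rw [abs_mul, abs_of_nonneg (by linarith)]
    calc _ ≤ 1 * |θ L - θ 0| := mul_le_mul_of_nonneg_right (by linarith) (abs_nonneg _)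
      _ ≤ _ := by linarith
  have e5 : (m : ℝ) * (δ * L + E) ≤ x / L * (δ * L + E) := by gcongr
  have e6 : |θ x - x / L * (θ L - θ 0)| ≤ x / L * (δ * L + E) + (2 * (C * L) + |θ 0|) := by
    have e7 := abs_le.1 (le_refl |θ 0|)
    rw [abs_le] at e1 e2 e4 ⊢
    constructor <;> linarith [e1.1, e1.2, e2.1, e2.2, e4.1, e4.2, e7.1, e7.2]
  have e8 : θ x / x - (θ L - θ 0) / L = (θ x - x / L * (θ L - θ 0)) / x := by
    field_simp
  rw [e8, abs_div, abs_of_pos hx, div_le_iff₀ hx]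
  refine e6.trans (le_of_eq ?_)
  field_simp

/-- A Lipschitz function whose increments over windows of each length are, up to a universal
constant, invariant under a relatively dense set of translations has a mean slope. -/
theorem exists_tendsto_div (hC : ∀ x y, |θ x - θ y| ≤ C * |x - y|)
    (h : ∀ T > 0, ∃ l, ∀ a, ∃ τ, |τ - a| ≤ l ∧
      ∀ s, |(θ (s + τ + T) - θ (s + τ)) - (θ (s + T) - θ s)| ≤ K) :
    ∃ R, Tendsto (fun t => θ t / t) atTop (𝓝 R) := by
  have hK : 0 ≤ K := by
    obtain ⟨l, hl⟩ := h 1 one_pos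
    obtain ⟨τ, -, H⟩ := hl 0
    exact (abs_nonneg _).trans (H 0)
  apply cauchySeq_tendsto_of_complete
  rw [Metric.cauchySeq_iff']
  intro ε hε
  -- Choose `T`, then `L`, then `X`, each making one of the three error terms at most `ε / 8`. The
  -- order matters, as `E` depends on `T`.
  have hT : 0 < 8 * (K + 1) / ε := by positivity
  obtain ⟨E, hE⟩ := exists_abs_increment_sub_le hC hT (h _ hT)
  set L := 8 * (|E| + 1) / ε with hL
  have hL0 : 0 < L := by positivity
  set X := 8 * (abs (2 * (C * L) + |θ 0|) + 1) / ε with hX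
  have hX0 : 0 < X := by positivity
  have key : ∀ x ≥ X, |θ x / x - (θ L - θ 0) / L| ≤ 3 * ε / 8 := by
    intro x hx
    have hx0 : 0 < x := hX0.trans_le hx
    refine (abs_div_sub_div_le hC (δ := K / (8 * (K + 1) / ε)) (E := |E|) (by positivity)
      (abs_nonneg _) (fun a L hL => (hE a L hL).trans (by gcongr; exact le_abs_self E))
      hL0 hx0).trans ?_
    have h1 : K / (8 * (K + 1) / ε) ≤ ε / 8 := by
      rw [div_le_iff₀ hT]; field_simp; linarith
    have h2 : |E| / L ≤ ε / 8 := by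
      rw [div_le_iff₀ hL0, hL]; field_simp; linarith
    have h3 : (2 * (C * L) + |θ 0|) / x ≤ ε / 8 := by
      rw [div_le_iff₀ hx0]
      have : 2 * (C * L) + |θ 0| ≤ ε / 8 * X := by
        have : ε / 8 * X = abs (2 * (C * L) + |θ 0|) + 1 := by rw [hX]; field_simp
        linarith [le_abs_self (2 * (C * L) + |θ 0|)]
      exact this.trans (by gcongr)
    linarith
  refine ⟨X, fun x hx => ?_⟩
  have h1 := key x hx
  have h2 := key X le_rfl
  rw [Real.dist_eq]
  rw [abs_le] at h1 h2
  rw [abs_lt]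
  constructor <;> linarith [h1.1, h1.2, h2.1, h2.2]

end Rotation

/-- A continuous function along a linear flow on a torus is almost periodic. -/
theorem exists_almost_period {m : ℕ} {E : Type*} [PseudoMetricSpace E]
    {F : (Fin m → UnitAddCircle) → E} (hF : Continuous F) (p q : Fin m → ℝ) {ε : ℝ} (hε : 0 < ε) :
    ∃ l : ℝ, ∀ a : ℝ, ∃ τ : ℝ, |τ - a| ≤ l ∧
      ∀ t : ℝ, dist (F fun i => ((p i + q i * (t + τ) : ℝ) : UnitAddCircle))
        (F fun i => ((p i + q i * t : ℝ) : UnitAddCircle)) ≤ ε := by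
  obtain ⟨δ, hδ, hFδ⟩ := Metric.uniformContinuous_iff.1
    (CompactSpace.uniformContinuous_of_continuous hF) ε hε
  set g : ℝ → Fin m → UnitAddCircle := fun t i => ((q i * t : ℝ) : UnitAddCircle) with hg
  -- A finite net of the orbit through `0` consists of points `g (s x)`. If `g a` is close to `g (s
  -- x)`, then `g (a - s x)` is close to `0`, so `a - s x` is an almost period at bounded distance
  -- from `a`.
  have htb : TotallyBounded (range g) :=
    (isCompact_univ (X := Fin m → UnitAddCircle)).totallyBounded.subset (subset_univ _)
  obtain ⟨c, hc, hcf, hcov⟩ := htb.exists_subset (Metric.dist_mem_uniformity hδ)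
  have hc' : ∀ x, x ∈ c → ∃ t, g t = x := fun x hx => hc hx
  choose! s hs using hc'
  obtain ⟨l, hl⟩ := (hcf.image fun x => |s x|).bddAbove
  refine ⟨l, fun a => ?_⟩
  obtain ⟨x, hx, hax⟩ := mem_iUnion₂.1 (hcov (mem_range_self a))
  refine ⟨a - s x, ?_, fun t => (hFδ ?_).le⟩
  · rw [sub_sub_cancel_left, abs_neg]
    exact hl (mem_image_of_mem _ hx)
  · have hax' : dist (g a) x < δ := hax
    rw [← hs x hx, dist_eq_norm] at hax'
    rw [dist_eq_norm]
    convert hax' using 2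
    ext i
    simp only [hg, Pi.sub_apply, ← AddCircle.coe_sub]
    congr 1
    ring

end HamiltonianMeanIndex

/-! ### Complex coordinates on `Sp(2)` -/

namespace HamiltonianMeanIndex

open Complex ComplexConjugate

/-- The complex-linear part of a real `2 × 2` matrix, times two. -/
noncomputable def linPart (M : Mat 1) : ℂ :=
  ⟨M (.inl 0) (.inl 0) + M (.inr 0) (.inr 0), M (.inr 0) (.inl 0) - M (.inl 0) (.inr 0)⟩

/-- The antilinear part of a real `2 × 2` matrix, times two. -/
noncomputable def antiPart (M : Mat 1) : ℂ :=
  ⟨M (.inl 0) (.inl 0) - M (.inr 0) (.inr 0), M (.inr 0) (.inl 0) + M (.inl 0) (.inr 0)⟩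

/-- The matrix with the given linear and antilinear parts. -/
noncomputable def ofParts (w z : ℂ) : Mat 1 :=
  Matrix.fromBlocks (.of fun _ _ => (w.re + z.re) / 2) (.of fun _ _ => (z.im - w.im) / 2)
    (.of fun _ _ => (w.im + z.im) / 2) (.of fun _ _ => (w.re - z.re) / 2)

@[simp] theorem linPart_ofParts (w z : ℂ) : linPart (ofParts w z) = w := by
  apply Complex.ext <;> simp [linPart, ofParts] <;> ring

@[simp] theorem antiPart_ofParts (w z : ℂ) : antiPart (ofParts w z) = z := by
  apply Complex.ext <;> simp [antiPart, ofParts] <;> ring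

theorem ofParts_linPart_antiPart (M : Mat 1) : ofParts (linPart M) (antiPart M) = M := by
  ext i j
  rcases i with i | i <;> rcases j with j | j <;> fin_cases i <;> fin_cases j <;>
    simp [linPart, antiPart, ofParts]

theorem continuous_linPart : Continuous linPart := by
  have : linPart = fun M : Mat 1 =>
      ((M (.inl 0) (.inl 0) + M (.inr 0) (.inr 0) : ℝ) : ℂ) +
        ((M (.inr 0) (.inl 0) - M (.inl 0) (.inr 0) : ℝ) : ℂ) * I := by
    funext M; apply Complex.ext <;> simp [linPart]
  rw [this]
  fun_prop

theorem continuous_antiPart : Continuous antiPart := by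
  have : antiPart = fun M : Mat 1 =>
      ((M (.inl 0) (.inl 0) - M (.inr 0) (.inr 0) : ℝ) : ℂ) +
        ((M (.inr 0) (.inl 0) + M (.inl 0) (.inr 0) : ℝ) : ℂ) * I := by
    funext M; apply Complex.ext <;> simp [antiPart]
  rw [this]
  fun_prop

theorem continuous_ofParts : Continuous fun p : ℂ × ℂ => ofParts p.1 p.2 := by
  refine continuous_matrix fun i j => ?_
  rcases i with i | i <;> rcases j with j | j <;> simp only [ofParts, Matrix.fromBlocks_apply₁₁,
    Matrix.fromBlocks_apply₁₂, Matrix.fromBlocks_apply₂₁, Matrix.fromBlocks_apply₂₂] <;> fun_prop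

theorem det_mat_one (M : Mat 1) : M.det =
    M (.inl 0) (.inl 0) * M (.inr 0) (.inr 0) - M (.inl 0) (.inr 0) * M (.inr 0) (.inl 0) := by
  rw [← Matrix.det_reindex_self (finSumFinEquiv (m := 1) (n := 1)), Matrix.det_fin_two]
  rfl

theorem mem_Sp_one_iff_det (M : Mat 1) : M ∈ Sp 1 ↔ M.det = 1 := by
  rw [det_mat_one]
  simp only [Set.mem_ofPred_eq, SymplecticGroup.mem_iff]
  constructor
  · intro h
    have := congrFun (congrFun h (.inr 0)) (.inl 0)
    simp [Matrix.mul_apply, Matrix.J, Matrix.transpose_apply] at this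
    linarith
  · intro h
    ext i j
    rcases i with i | i <;> rcases j with j | j <;> fin_cases i <;> fin_cases j <;>
      simp [Matrix.mul_apply, Matrix.J, Matrix.transpose_apply] <;> linarith

theorem norm_sq_linPart_sub (M : Mat 1) : ‖linPart M‖ ^ 2 - ‖antiPart M‖ ^ 2 = 4 * M.det := by
  rw [← normSq_eq_norm_sq, ← normSq_eq_norm_sq, normSq_apply, normSq_apply, det_mat_one]
  simp only [linPart, antiPart]
  ring

theorem mem_Sp_one_iff (M : Mat 1) : M ∈ Sp 1 ↔ ‖linPart M‖ ^ 2 - ‖antiPart M‖ ^ 2 = 4 := by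
  rw [mem_Sp_one_iff_det, norm_sq_linPart_sub]
  constructor <;> intro h <;> linarith

theorem two_le_norm_linPart {M : Mat 1} (h : M ∈ Sp 1) : 2 ≤ ‖linPart M‖ := by
  rw [mem_Sp_one_iff] at h
  nlinarith [sq_nonneg ‖antiPart M‖, norm_nonneg (linPart M)]

/-- For determinant `1`, `det (M - I) = 2 - tr M`. -/
theorem degen_eq {M : Mat 1} (h : M ∈ Sp 1) : degen M = 2 - (linPart M).re := by
  rw [mem_Sp_one_iff_det, det_mat_one] at h
  rw [degen, det_mat_one]
  simp [linPart, Matrix.sub_apply]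
  linarith

theorem linPart_mul (M N : Mat 1) :
    linPart (M * N) = (linPart M * linPart N + antiPart M * conj (antiPart N)) / 2 := by
  apply Complex.ext <;> simp [linPart, antiPart, Matrix.mul_apply] <;> ring

theorem linPart_expJ (s : ℝ) : linPart (expJ 1 s) = 2 * exp (s * I) := by
  apply Complex.ext <;>
    simp [linPart, expJ, J, Matrix.J, Complex.exp_ofReal_mul_I_re, Complex.exp_ofReal_mul_I_im] <;>
    ring

theorem antiPart_expJ (s : ℝ) : antiPart (expJ 1 s) = 0 := by
  apply Complex.ext <;> simp [antiPart, expJ, J, Matrix.J]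

theorem linPart_mul_expJ (M : Mat 1) (s : ℝ) :
    linPart (M * expJ 1 s) = linPart M * exp (s * I) := by
  rw [linPart_mul, linPart_expJ, antiPart_expJ]; simp; ring

theorem linPart_expJ_mul (M : Mat 1) (s : ℝ) :
    linPart (expJ 1 s * M) = linPart M * exp (s * I) := by
  rw [linPart_mul, linPart_expJ, antiPart_expJ]; simp; ring

theorem expJ_mem_Sp (s : ℝ) : expJ 1 s ∈ Sp 1 := by
  rw [mem_Sp_one_iff, linPart_expJ, antiPart_expJ]
  simp [Complex.norm_exp_ofReal_mul_I]; norm_num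

theorem mul_mem_Sp {M N : Mat 1} (hM : M ∈ Sp 1) (hN : N ∈ Sp 1) : M * N ∈ Sp 1 :=
  mul_mem (S := Submonoid (Mat 1)) (s := Matrix.symplecticGroup (Fin 1) ℝ) hM hN

/-- The complex form of a planar vector. -/
noncomputable def toComplex (v : Fin 1 ⊕ Fin 1 → ℝ) : ℂ := ⟨v (.inl 0), v (.inr 0)⟩

/-- Half the trace of a coefficient matrix. -/
noncomputable def isoCoeff (B : Mat 1) : ℝ := (B (.inl 0) (.inl 0) + B (.inr 0) (.inr 0)) / 2

/-- The trace-free part of a symmetric coefficient matrix, as a complex number. -/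
noncomputable def anisoCoeff (B : Mat 1) : ℂ :=
  ⟨(B (.inl 0) (.inl 0) - B (.inr 0) (.inr 0)) / 2, B (.inl 0) (.inr 0)⟩

theorem continuous_isoCoeff : Continuous isoCoeff := by unfold isoCoeff; fun_prop

theorem continuous_anisoCoeff : Continuous anisoCoeff := by
  have : anisoCoeff = fun B : Mat 1 =>
      (((B (.inl 0) (.inl 0) - B (.inr 0) (.inr 0)) / 2 : ℝ) : ℂ) +
        ((B (.inl 0) (.inr 0) : ℝ) : ℂ) * I := by
    funext M; apply Complex.ext <;> simp [anisoCoeff]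
  rw [this]
  fun_prop

theorem hasDerivAt_complex {f g : ℝ → ℝ} {f' g' t : ℝ} (hf : HasDerivAt f f' t)
    (hg : HasDerivAt g g' t) : HasDerivAt (fun t => (⟨f t, g t⟩ : ℂ)) ⟨f', g'⟩ t := by
  have h := hf.ofReal_comp.add (hg.ofReal_comp.mul_const I)
  have e : (fun t => (⟨f t, g t⟩ : ℂ)) = (fun t => (f t : ℂ)) + fun t => (g t : ℂ) * I := by
    funext t; apply Complex.ext <;> simp
  rw [e]
  refine h.congr_deriv ?_
  apply Complex.ext <;> simp

theorem IsFundamentalSolution.isPropagator {B γ : ℝ → Mat 1} (hγ : IsFundamentalSolution B γ)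
    (hB : ∀ t, (B t).IsSymm) :
    IsPropagator (fun t => isoCoeff (B t)) (fun t => anisoCoeff (B t)) (fun t => linPart (γ t))
      (fun t => antiPart (γ t)) := by
  obtain ⟨h0, hd⟩ := hγ
  refine ⟨fun t => ?_, ?_, ?_⟩
  · have hs : B t (.inr 0) (.inl 0) = B t (.inl 0) (.inr 0) := (hB t).apply _ _
    constructor
    · refine (hasDerivAt_complex ((hd t (.inl 0) (.inl 0)).add (hd t (.inr 0) (.inr 0)))
        ((hd t (.inr 0) (.inl 0)).sub (hd t (.inl 0) (.inr 0)))).congr_deriv ?_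
      apply Complex.ext <;>
        simp [linPart, antiPart, isoCoeff, anisoCoeff, Matrix.mul_apply, J, Matrix.J, hs] <;> ring
    · refine (hasDerivAt_complex ((hd t (.inl 0) (.inl 0)).sub (hd t (.inr 0) (.inr 0)))
        ((hd t (.inr 0) (.inl 0)).add (hd t (.inl 0) (.inr 0)))).congr_deriv ?_
      apply Complex.ext <;>
        simp [linPart, antiPart, isoCoeff, anisoCoeff, Matrix.mul_apply, J, Matrix.J, hs] <;> ring
  · apply Complex.ext <;> simp [linPart, h0]; norm_num
  · apply Complex.ext <;> simp [antiPart, h0]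

theorem IsSolution.isPairSolution {B : ℝ → Mat 1} {z : ℝ → Fin 1 ⊕ Fin 1 → ℝ}
    (hz : IsSolution B z) (hB : ∀ t, (B t).IsSymm) :
    IsPairSolution (fun t => isoCoeff (B t)) (fun t => anisoCoeff (B t))
      (fun t => toComplex (z t)) (fun t => toComplex (z t)) := by
  have key : ∀ t, HasDerivAt (fun t => toComplex (z t)) (I * (isoCoeff (B t) * toComplex (z t) +
      anisoCoeff (B t) * conj (toComplex (z t)))) t := by
    intro t
    have hs : B t (.inr 0) (.inl 0) = B t (.inl 0) (.inr 0) := (hB t).apply _ _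
    have h := hasDerivAt_pi.1 (hz t)
    refine (hasDerivAt_complex (h (.inl 0)) (h (.inr 0))).congr_deriv ?_
    apply Complex.ext <;>
      simp [toComplex, isoCoeff, anisoCoeff, Matrix.mulVec, dotProduct, Matrix.mul_apply, J,
        Matrix.J, hs] <;> ring
  exact fun t => ⟨key t, key t⟩

end HamiltonianMeanIndex

/-! ### The phase index and its jumps -/

namespace HamiltonianMeanIndex

section Phase

/-- The index of the component, in the universal cover of the complement of the degenerate
hypersurface, of a symplectic matrix whose linear part has argument `φ` and real part `x`. -/
noncomputable def phaseIndex (φ x : ℝ) : ℤ :=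
  -- If `x > 2` then `cos φ > 0` and `φ` lies near a multiple `2πn`: index `2n`. If `x < 2` then
  -- `cos φ ≠ 1` because `|w| ≥ 2`, and `φ` lies between `2πn` and `2π(n + 1)`: index `2n + 1`.
  if 2 < x then 2 * ⌊φ / (2 * Real.pi) + 1 / 2⌋ else 2 * ⌊φ / (2 * Real.pi)⌋ + 1

theorem abs_pi_mul_phaseIndex_sub_le (φ x : ℝ) : |Real.pi * phaseIndex φ x - φ| ≤ Real.pi := by
  have hpi := Real.pi_pos
  have e : φ = 2 * Real.pi * (φ / (2 * Real.pi)) := by field_simp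
  set y := φ / (2 * Real.pi)
  rw [abs_le, phaseIndex]
  split_ifs
  · have h1 := Int.floor_le (y + 1 / 2)
    have h2 := Int.lt_floor_add_one (y + 1 / 2)
    push_cast
    constructor <;> nlinarith
  · have h1 := Int.floor_le y
    have h2 := Int.lt_floor_add_one y
    push_cast
    constructor <;> nlinarith

theorem eventually_floor_eq {y : ℝ} (h : (⌊y⌋ : ℝ) ≠ y) : ∀ᶠ u in 𝓝 y, ⌊u⌋ = ⌊y⌋ := by
  filter_upwards [Ioo_mem_nhds (lt_of_le_of_ne (Int.floor_le y) h) (Int.lt_floor_add_one y)]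
    with u hu
  exact Int.floor_eq_iff.2 ⟨hu.1.le, hu.2⟩

theorem floor_ne_of_cos_ne_one {φ : ℝ} (h : Real.cos φ ≠ 1) :
    (⌊φ / (2 * Real.pi)⌋ : ℝ) ≠ φ / (2 * Real.pi) := by
  intro e
  apply h
  have : φ = ⌊φ / (2 * Real.pi)⌋ * (2 * Real.pi) := by
    rw [e]; field_simp
  rw [this, Real.cos_int_mul_two_pi]

theorem floor_ne_of_cos_ne_neg_one {φ : ℝ} (h : Real.cos φ ≠ -1) :
    (⌊φ / (2 * Real.pi) + 1 / 2⌋ : ℝ) ≠ φ / (2 * Real.pi) + 1 / 2 := by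
  intro e
  apply h
  have : φ = ⌊φ / (2 * Real.pi) + 1 / 2⌋ * (2 * Real.pi) - Real.pi := by
    rw [e]; field_simp; ring
  rw [this, Real.cos_int_mul_two_pi_sub_pi]

theorem floor_eq_of_sin_pos {φ : ℝ} (hs : 0 < Real.sin φ) :
    ⌊φ / (2 * Real.pi) + 1 / 2⌋ = ⌊φ / (2 * Real.pi)⌋ := by
  have hpi := Real.pi_pos
  have e : φ = 2 * Real.pi * (φ / (2 * Real.pi)) := by field_simp
  set y := φ / (2 * Real.pi)
  set n := ⌊y⌋
  have h1 := Int.floor_le y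
  have h2 := Int.lt_floor_add_one y
  rw [← Real.sin_sub_int_mul_two_pi φ n] at hs
  rw [Int.floor_eq_iff]
  refine ⟨by linarith, ?_⟩
  by_contra! hcon
  have h3 : Real.pi ≤ φ - n * (2 * Real.pi) := by nlinarith
  have h4 : φ - n * (2 * Real.pi) ≤ 2 * Real.pi := by nlinarith
  have := Real.sin_nonpos_of_nonpos_of_neg_pi_le
    (x := φ - n * (2 * Real.pi) - 2 * Real.pi) (by linarith) (by linarith)
  rw [Real.sin_sub_two_pi] at this
  linarith

theorem floor_eq_of_sin_neg {φ : ℝ} (hs : Real.sin φ < 0) :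
    ⌊φ / (2 * Real.pi) + 1 / 2⌋ = ⌊φ / (2 * Real.pi)⌋ + 1 := by
  have hpi := Real.pi_pos
  have e : φ = 2 * Real.pi * (φ / (2 * Real.pi)) := by field_simp
  set y := φ / (2 * Real.pi)
  set n := ⌊y⌋
  have h1 := Int.floor_le y
  have h2 := Int.lt_floor_add_one y
  rw [← Real.sin_sub_int_mul_two_pi φ n] at hs
  rw [Int.floor_eq_iff]
  push_cast
  refine ⟨?_, by linarith⟩
  by_contra! hcon
  have := Real.sin_nonneg_of_nonneg_of_le_pi (x := φ - n * (2 * Real.pi)) (by nlinarith)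
    (by nlinarith)
  linarith

variable {w : ℝ → ℂ} {φ : ℝ → ℝ}

theorem IsPhase.re_eq (h : IsPhase w φ) (t : ℝ) : (w t).re = ‖w t‖ * Real.cos (φ t) := by
  conv_lhs => rw [h.2 t]
  rw [Complex.re_ofReal_mul, Complex.exp_ofReal_mul_I_re]

theorem IsPhase.im_eq (h : IsPhase w φ) (t : ℝ) : (w t).im = ‖w t‖ * Real.sin (φ t) := by
  conv_lhs => rw [h.2 t]
  rw [Complex.im_ofReal_mul, Complex.exp_ofReal_mul_I_im]

/-- Off the hypersurface, `|w| ≥ 2` keeps `φ` away from the discontinuities of the floor in use: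
`cos φ = 1` would force `Re w ≥ 2`, and `cos φ = -1` would force `Re w < 0`. -/
theorem IsPhase.eventually_phaseIndex_eq (h : IsPhase w φ) (hw : Continuous w)
    (h2 : ∀ t, 2 ≤ ‖w t‖) {t : ℝ} (ht : (w t).re ≠ 2) :
    ∀ᶠ s in 𝓝 t, phaseIndex (φ s) (w s).re = phaseIndex (φ t) (w t).re := by
  have hre : ContinuousAt (fun s => (w s).re) t := by fun_prop
  have hφ := h.1
  rcases ht.lt_or_gt with hlt | hgt
  · have hc : Real.cos (φ t) ≠ 1 := by
      intro hc
      have := h.re_eq t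
      rw [hc] at this
      linarith [h2 t]
    have hf := (show ContinuousAt (fun s => φ s / (2 * Real.pi)) t by fun_prop).eventually
      (eventually_floor_eq (floor_ne_of_cos_ne_one hc))
    filter_upwards [hre.eventually (gt_mem_nhds hlt), hf] with s h1 h3
    rw [phaseIndex, phaseIndex, if_neg h1.not_gt, if_neg hlt.not_gt, h3]
  · have hc : Real.cos (φ t) ≠ -1 := by
      intro hc
      have := h.re_eq t
      rw [hc] at this
      linarith [h2 t]
    have hf := (show ContinuousAt (fun s => φ s / (2 * Real.pi) + 1 / 2) t by
      fun_prop).eventually (eventually_floor_eq (floor_ne_of_cos_ne_neg_one hc))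
    filter_upwards [hre.eventually (lt_mem_nhds hgt), hf] with s h1 h3
    rw [phaseIndex, phaseIndex, if_pos h1, if_pos hgt, h3]

theorem eventually_lt_of_hasDerivAt_pos {f : ℝ → ℝ} {d t : ℝ} (h : HasDerivAt f d t) (hd : 0 < d) :
    (∀ᶠ s in 𝓝[<] t, f s < f t) ∧ ∀ᶠ s in 𝓝[>] t, f t < f s := by
  have h1 := (hasDerivAt_iff_tendsto_slope.1 h).eventually (lt_mem_nhds hd)
  constructor
  · filter_upwards [h1.filter_mono (nhdsWithin_mono _ fun x (hx : x < t) => hx.ne),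
      self_mem_nhdsWithin] with s hs (hst : s < t)
    rw [slope_def_field] at hs
    by_contra! hcon
    exact absurd hs (div_nonpos_of_nonneg_of_nonpos (by linarith) (by linarith)).not_gt
  · filter_upwards [h1.filter_mono (nhdsWithin_mono _ fun x (hx : t < x) => hx.ne'),
      self_mem_nhdsWithin] with s hs (hst : t < s)
    rw [slope_def_field] at hs
    by_contra! hcon
    exact absurd hs (div_nonpos_of_nonpos_of_nonneg (by linarith) (by linarith)).not_gt

/-- Both floors are constant near the crossing, so only the branch of `phaseIndex` changes. The sign
of `d` says which branch comes first, and the sign of `Im w` which of the two values is larger. -/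
theorem IsPhase.phaseIndex_jump (h : IsPhase w φ) (h2 : ∀ t, 2 ≤ ‖w t‖) {t d : ℝ}
    (ht : (w t).re = 2) (hd : HasDerivAt (fun s => 2 - (w s).re) d t) (hd0 : d ≠ 0)
    (him : (w t).im ≠ 0) :
    ∃ c : ℤ, (∀ᶠ s in 𝓝[<] t, phaseIndex (φ s) (w s).re = c) ∧
      ∀ᶠ s in 𝓝[>] t, phaseIndex (φ s) (w s).re =
        c + (SignType.sign d : ℤ) * (SignType.sign (w t).im : ℤ) := by
  have hφ := h.1
  have hn : 0 < ‖w t‖ := by linarith [h2 t]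
  have hcos : 0 < Real.cos (φ t) := by
    have := h.re_eq t
    rw [ht] at this
    exact pos_of_mul_pos_right (this ▸ two_pos) hn.le
  have hsin : Real.sin (φ t) ≠ 0 := by
    intro h0
    exact him (by rw [h.im_eq t, h0, mul_zero])
  have hc1 : Real.cos (φ t) ≠ 1 := by
    intro hc
    apply hsin
    have := Real.sin_sq_add_cos_sq (φ t)
    rw [hc] at this
    nlinarith
  have hf1 := (show ContinuousAt (fun s => φ s / (2 * Real.pi)) t by fun_prop).eventually
      (eventually_floor_eq (floor_ne_of_cos_ne_one hc1))
  have hf2 := (show ContinuousAt (fun s => φ s / (2 * Real.pi) + 1 / 2) t by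
      fun_prop).eventually (eventually_floor_eq (floor_ne_of_cos_ne_neg_one
        (by linarith : Real.cos (φ t) ≠ -1)))
  set a := ⌊φ t / (2 * Real.pi)⌋
  have hhyp : ∀ᶠ s in 𝓝 t, 2 < (w s).re →
      phaseIndex (φ s) (w s).re = 2 * ⌊φ t / (2 * Real.pi) + 1 / 2⌋ := by
    filter_upwards [hf2] with s hs hs'
    rw [phaseIndex, if_pos hs', hs]
  have hell : ∀ᶠ s in 𝓝 t, (w s).re < 2 → phaseIndex (φ s) (w s).re = 2 * a + 1 := by
    filter_upwards [hf1] with s hs hs'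
    rw [phaseIndex, if_neg hs'.not_gt, hs]
  have hjump : 2 * a + 1 = 2 * ⌊φ t / (2 * Real.pi) + 1 / 2⌋ + (SignType.sign (w t).im : ℤ) := by
    rcases hsin.lt_or_gt with hs | hs
    · rw [floor_eq_of_sin_neg hs, h.im_eq t, sign_neg (mul_neg_of_pos_of_neg hn hs)]
      simp
      ring
    · rw [floor_eq_of_sin_pos hs, h.im_eq t, sign_pos (mul_pos hn hs)]
      simp
      rfl
  rcases hd0.lt_or_gt with hneg | hpos
  · obtain ⟨l1, l2⟩ := eventually_lt_of_hasDerivAt_pos (hd.neg) (neg_pos.2 hneg)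
    refine ⟨2 * a + 1, ?_, ?_⟩
    · filter_upwards [l1, nhdsWithin_le_nhds hell] with s h1 h3
      simp only [Pi.neg_apply] at h1
      exact h3 (by linarith)
    · filter_upwards [l2, nhdsWithin_le_nhds hhyp] with s h1 h3
      simp only [Pi.neg_apply] at h1
      rw [h3 (by linarith), sign_neg hneg, hjump]
      simp
  · obtain ⟨l1, l2⟩ := eventually_lt_of_hasDerivAt_pos hd hpos
    refine ⟨2 * ⌊φ t / (2 * Real.pi) + 1 / 2⌋, ?_, ?_⟩
    · filter_upwards [l1, nhdsWithin_le_nhds hhyp] with s h1 h3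
      exact h3 (by linarith)
    · filter_upwards [l2, nhdsWithin_le_nhds hell] with s h1 h3
      rw [h3 (by linarith), sign_pos hpos, hjump]
      simp

end Phase

/-! ### Counting the jumps of an integer-valued function -/

section Jump

/-- The punctured limit `c` is locally constant, since punctured neighbourhoods of nearby points
overlap; the interval is connected. -/
theorem eq_of_eventually_punctured {G : ℝ → ℤ} {l : ℝ} (hl : 0 ≤ l) {c : ℝ → ℤ}
    (h : ∀ t ∈ Icc 0 l, ∀ᶠ s in 𝓝[≠] t, G s = c t) : c 0 = c l := by
  have hc : ContinuousOn c (Icc 0 l) := by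
    intro t ht
    refine tendsto_nhds_of_eventually_eq ?_
    rw [eventually_nhdsWithin_iff]
    have h1 := eventually_eventually_nhdsWithin.2 (h t ht)
    rw [eventually_nhdsWithin_iff] at h1
    filter_upwards [h1] with s hs hsl
    rcases eq_or_ne s t with rfl | hst
    · rfl
    · have h2 := hs hst
      rw [nhdsWithin_eq_nhds.2 (isOpen_compl_singleton.mem_nhds hst)] at h2
      obtain ⟨u, hu1, hu2⟩ := ((h s hsl).and (nhdsWithin_le_nhds h2)).exists
      exact hu1.symm.trans hu2
  exact isPreconnected_Icc.constant hc (left_mem_Icc.2 hl) (right_mem_Icc.2 hl)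

theorem eventually_sum_jumps (C : Finset ℝ) (σ : ℝ → ℤ) (t : ℝ) :
    (∀ᶠ s in 𝓝[<] t, (∑ c ∈ C, if c < s then σ c else 0) = ∑ c ∈ C, if c < t then σ c else 0) ∧
    ∀ᶠ s in 𝓝[>] t, (∑ c ∈ C, if c < s then σ c else 0) =
      (∑ c ∈ C, if c < t then σ c else 0) + if t ∈ C then σ t else 0 := by
  constructor
  · have : ∀ᶠ s in 𝓝[<] t, ∀ c ∈ C, (c < s ↔ c < t) := by
      rw [Filter.eventually_all_finset]
      intro c _
      by_cases hct : c < t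
      · filter_upwards [nhdsWithin_le_nhds (lt_mem_nhds hct)] with s hs
        exact ⟨fun _ => hct, fun _ => hs⟩
      · filter_upwards [self_mem_nhdsWithin] with s (hs : s < t)
        exact ⟨fun h => h.trans hs, fun h => absurd h hct⟩
    filter_upwards [this] with s hs
    exact Finset.sum_congr rfl fun c hc => by simp only [hs c hc]
  · have : ∀ᶠ s in 𝓝[>] t, ∀ c ∈ C, (c < s ↔ c ≤ t) := by
      rw [Filter.eventually_all_finset]
      intro c _
      by_cases hct : c ≤ t
      · filter_upwards [self_mem_nhdsWithin] with s (hs : t < s)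
        exact ⟨fun _ => hct, fun _ => hct.trans_lt hs⟩
      · filter_upwards [nhdsWithin_le_nhds (gt_mem_nhds (not_le.1 hct))] with s hs
        exact ⟨fun h => absurd h hs.not_gt, fun h => absurd h hct⟩
    filter_upwards [this] with s hs
    rw [← Finset.sum_ite_eq C t σ, ← Finset.sum_add_distrib]
    refine Finset.sum_congr rfl fun c hc => ?_
    simp only [hs c hc]
    rcases lt_trichotomy c t with h | h | h
    · simp [h.le, h, h.ne']
    · simp [h]
    · simp [h.not_ge, h.not_gt, h.ne]

/-- An integer-valued function that is locally constant off finitely many interior points changes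
by the sum of its jumps. -/
theorem sub_eq_sum_jumps {g : ℝ → ℤ} {l : ℝ} (hl : 0 ≤ l) {C : Finset ℝ} {σ : ℝ → ℤ}
    (hC : ∀ t ∈ C, t ∈ Ioo 0 l) (h1 : ∀ t ∈ Icc 0 l, t ∉ C → ∀ᶠ s in 𝓝 t, g s = g t)
    (h2 : ∀ t ∈ C, ∃ c, (∀ᶠ s in 𝓝[<] t, g s = c) ∧ ∀ᶠ s in 𝓝[>] t, g s = c + σ t) :
    g l - g 0 = ∑ t ∈ C, σ t := by
  -- Subtracting the step function with the same jumps leaves a function with equal one-sided limits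
  -- everywhere.
  set S : ℝ → ℤ := fun s => ∑ c ∈ C, if c < s then σ c else 0 with hS
  have key : ∀ t ∈ Icc 0 l, ∃ c, (∀ᶠ s in 𝓝[≠] t, g s - S s = c) ∧ (t ∉ C → c = g t - S t) := by
    intro t ht
    obtain ⟨s1, s2⟩ := eventually_sum_jumps C σ t
    by_cases htC : t ∈ C
    · obtain ⟨c, c1, c2⟩ := h2 t htC
      refine ⟨c - S t, ?_, fun h => absurd htC h⟩
      rw [← Iio_union_Ioi, nhdsWithin_union, eventually_sup]
      constructor
      · filter_upwards [s1, c1] with s e1 e2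
        simp only [hS, e1, e2]
      · filter_upwards [s2, c2] with s e1 e2
        simp only [hS, e1, e2, if_pos htC]
        ring
    · refine ⟨g t - S t, ?_, fun _ => rfl⟩
      rw [← Iio_union_Ioi, nhdsWithin_union, eventually_sup]
      constructor
      · filter_upwards [s1, nhdsWithin_le_nhds (h1 t ht htC)] with s e1 e2
        simp only [hS, e1, e2]
      · filter_upwards [s2, nhdsWithin_le_nhds (h1 t ht htC)] with s e1 e2
        simp only [hS, e1, e2, if_neg htC, add_zero]
  choose! c hc1 hc2 using key
  have h0 := eq_of_eventually_punctured hl hc1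
  rw [hc2 0 (left_mem_Icc.2 hl) fun h => lt_irrefl _ (hC _ h).1,
    hc2 l (right_mem_Icc.2 hl) fun h => lt_irrefl _ (hC _ h).2] at h0
  have e0 : S 0 = 0 := Finset.sum_eq_zero fun c hc => if_neg (hC c hc).1.not_gt
  have e1 : S l = ∑ t ∈ C, σ t := Finset.sum_congr rfl fun c hc => if_pos (hC c hc).2
  rw [e0, e1] at h0
  linarith

end Jump

end HamiltonianMeanIndex

/-! ### The intersection number as a difference of phase indices -/

namespace HamiltonianMeanIndex

open Complex

/-- At a point of the hypersurface, the co-orientation is thus given by the sign of `Im w`. -/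
theorem deriv_degen_mul_expJ {M : Mat 1} (hM : M ∈ Sp 1) :
    deriv (fun s => degen (M * expJ 1 s)) 0 = (linPart M).im := by
  have e : (fun s => degen (M * expJ 1 s)) = fun s : ℝ =>
      2 - ((linPart M).re * Real.cos s - (linPart M).im * Real.sin s) := by
    funext s
    rw [degen_eq (mul_mem_Sp hM (expJ_mem_Sp s)), linPart_mul_expJ, Complex.mul_re,
      Complex.exp_ofReal_mul_I_re, Complex.exp_ofReal_mul_I_im]
  rw [e]
  have h := (((Real.hasDerivAt_cos 0).const_mul (linPart M).re).sub
    ((Real.hasDerivAt_sin 0).const_mul (linPart M).im)).const_sub 2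
  exact h.deriv.trans (by simp)

/-- If `w = 2`, then `|w|²` is at its minimum `4` on `Sp(2)`, so its derivative `4 (Re w)'`
vanishes, against transversality. -/
theorem linPart_im_ne_zero_of_isTransverseAt {β : ℝ → Mat 1} {t : ℝ}
    (hβ : ∀ᶠ s in 𝓝 t, β s ∈ Sp 1) (h0 : degen (β t) = 0) (h : IsTransverseAt β t) :
    (linPart (β t)).im ≠ 0 := by
  intro him
  obtain ⟨hd, hne⟩ := h
  have hre : DifferentiableAt ℝ (fun s => (linPart (β s)).re) t :=
    (hd (.inl 0) (.inl 0)).add (hd (.inr 0) (.inr 0))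
  have hi : DifferentiableAt ℝ (fun s => (linPart (β s)).im) t :=
    (hd (.inr 0) (.inl 0)).sub (hd (.inl 0) (.inr 0))
  have hβt : β t ∈ Sp 1 := hβ.self_of_nhds
  have hr2 : (linPart (β t)).re = 2 := by
    rw [degen_eq hβt] at h0; linarith
  have hmin : IsLocalMin (fun s => (linPart (β s)).re ^ 2 + (linPart (β s)).im ^ 2) t := by
    filter_upwards [hβ] with s hs
    rw [hr2, him]
    have h1 := two_le_norm_linPart hs
    have h2 := normSq_eq_norm_sq (linPart (β s))
    rw [normSq_apply] at h2
    nlinarith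
  have h1 := hmin.hasDerivAt_eq_zero ((hre.hasDerivAt.pow 2).add (hi.hasDerivAt.pow 2))
  rw [him, hr2] at h1
  apply hne
  have e : (fun s => degen (β s)) =ᶠ[𝓝 t] fun s => 2 - (linPart (β s)).re := by
    filter_upwards [hβ] with s hs using degen_eq hs
  rw [e.deriv_eq, (hre.hasDerivAt.const_sub 2).deriv]
  norm_num at h1
  linarith

/-- The signed number of transversal crossings of a path is the change of the index of its
lift. -/
theorem sum_crossingSign_eq {β : ℝ → Mat 1} {l : ℝ} (hl : 0 < l) {C : Finset ℝ} {w : ℝ → ℂ}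
    {ψ : ℝ → ℝ} (hw : Continuous w) (hwβ : ∀ t ∈ Icc 0 l, w t = linPart (β t))
    (h2 : ∀ t, 2 ≤ ‖w t‖) (hβ : ∀ t ∈ Icc 0 l, β t ∈ Sp 1) (hψ : IsPhase w ψ)
    (h0 : degen (β 0) ≠ 0) (h1 : degen (β l) ≠ 0)
    (hC : ∀ t, t ∈ C ↔ t ∈ Icc 0 l ∧ degen (β t) = 0) (hT : ∀ t ∈ C, IsTransverseAt β t) :
    ∑ t ∈ C, crossingSign β t = phaseIndex (ψ l) (w l).re - phaseIndex (ψ 0) (w 0).re := by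
  symm
  have hCI : ∀ t ∈ C, t ∈ Ioo 0 l := by
    intro t ht
    obtain ⟨⟨a, b⟩, hd⟩ := (hC t).1 ht
    refine ⟨lt_of_le_of_ne a ?_, lt_of_le_of_ne b ?_⟩
    · rintro rfl; exact h0 hd
    · rintro rfl; exact h1 hd
  refine sub_eq_sum_jumps (g := fun t => phaseIndex (ψ t) (w t).re) hl.le hCI ?_ ?_
  · intro t ht htC
    refine hψ.eventually_phaseIndex_eq hw h2 fun hre => htC ((hC t).2 ⟨ht, ?_⟩)
    rw [degen_eq (hβ t ht), ← hwβ t ht, hre, sub_self]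
  · intro t ht
    have hnhds : ∀ᶠ s in 𝓝 t, s ∈ Icc 0 l := Icc_mem_nhds (hCI t ht).1 (hCI t ht).2
    have htI := ((hC t).1 ht).1
    have hdt := ((hC t).1 ht).2
    have hβn : ∀ᶠ s in 𝓝 t, β s ∈ Sp 1 := hnhds.mono hβ
    have him := linPart_im_ne_zero_of_isTransverseAt hβn hdt (hT t ht)
    have e : (fun s => degen (β s)) =ᶠ[𝓝 t] fun s => 2 - (w s).re := by
      filter_upwards [hnhds] with s hs
      rw [degen_eq (hβ s hs), hwβ s hs]
    have hne := (hT t ht).2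
    rw [crossingSign, deriv_degen_mul_expJ (hβ t htI)]
    rw [e.deriv_eq] at hne ⊢
    rw [← hwβ t htI] at him ⊢
    refine hψ.phaseIndex_jump h2 ?_ (differentiableAt_of_deriv_ne_zero hne).hasDerivAt hne him
    rw [degen_eq (hβ t htI), ← hwβ t htI] at hdt
    linarith

/-- Lift the argument along the homotopy. With fixed end points, the lifts of `α` and of its
transversal representative have the same end values, and the count for the latter is known. -/
theorem HasIntersectionNumber.eq_phaseIndex_sub {α : ℝ → Mat 1} {l : ℝ} (hl : 0 < l) {k : ℤ}
    (h : HasIntersectionNumber l α k) {φ : ℝ → ℝ} (hφ : IsPhase (fun t => linPart (α t)) φ) :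
    k = phaseIndex (φ l) (linPart (α l)).re - phaseIndex (φ 0) (linPart (α 0)).re := by
  obtain ⟨h0, h1, β, C, ⟨H, Hc, HS, Hαβ, Hend⟩, hC, hT, rfl⟩ := h
  have pI : ∀ s, (projIcc (0 : ℝ) 1 zero_le_one s : ℝ) ∈ Icc (0 : ℝ) 1 := fun s => Subtype.mem _
  have pL : ∀ t, (projIcc (0 : ℝ) l hl.le t : ℝ) ∈ Icc (0 : ℝ) l := fun t => Subtype.mem _
  -- Clamping both variables extends the homotopy to the whole plane, which is simply connected.
  set W : ℝ × ℝ → ℂ := fun p =>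
    linPart (H (projIcc (0 : ℝ) 1 zero_le_one p.1, projIcc (0 : ℝ) l hl.le p.2)) with hW
  have hWS : ∀ p, 2 ≤ ‖W p‖ := fun p => two_le_norm_linPart (HS _ (pI _) _ (pL _))
  have hW0 : ∀ p, W p ≠ 0 := fun p => norm_pos_iff.1 (by linarith [hWS p])
  have hWc : Continuous W := by
    refine continuous_linPart.comp (Hc.comp_continuous ?_ fun p => ⟨pI _, pL _⟩)
    exact (continuous_subtype_val.comp (continuous_projIcc.comp continuous_fst)).prodMk
      (continuous_subtype_val.comp (continuous_projIcc.comp continuous_snd))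
  have z0 : (0 : ℝ) ∈ Icc 0 l := left_mem_Icc.2 hl.le
  have zl : l ∈ Icc 0 l := right_mem_Icc.2 hl.le
  have W0 : ∀ t, W (0, t) = linPart (α (projIcc 0 l hl.le t)) := by
    intro t
    simp only [hW, projIcc_left]
    rw [(Hαβ _ (pL t)).1]
  have W1 : ∀ t ∈ Icc 0 l, W (1, t) = linPart (β t) := by
    intro t ht
    simp only [hW, projIcc_right, projIcc_of_mem _ ht]
    rw [(Hαβ t ht).2]
  have Ws0 : ∀ s, W (s, 0) = linPart (α 0) := by
    intro s
    simp only [hW, projIcc_left]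
    rw [(Hend _ (pI s)).1]
  have Wsl : ∀ s, W (s, l) = linPart (α l) := by
    intro s
    simp only [hW, projIcc_right]
    rw [(Hend _ (pI s)).2]
  obtain ⟨Φ, hΦ, hΦ0⟩ := exists_phase hWc hW0 (0, 0) (φ₀ := φ 0) (by
    rw [Ws0]; exact hφ.2 0)
  have c1 : ∀ t ∈ Icc 0 l, Φ (0, t) = φ t := by
    intro t ht
    have := phase_unique (w := fun t => W (0, t)) (φ₁ := fun t => Φ (0, t))
      (φ₂ := fun t => φ (projIcc 0 l hl.le t)) ⟨hΦ.1.comp (by fun_prop), fun t => hΦ.2 _⟩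
      ⟨hφ.1.comp (continuous_subtype_val.comp continuous_projIcc), fun t => by
        simp only [W0]; exact hφ.2 _⟩ (by simp [hΦ0]) (fun t => hW0 _) ht.1
    simpa [projIcc_of_mem _ ht] using this
  have c2 : ∀ t ∈ ({0, l} : Set ℝ), Φ (1, t) = Φ (0, t) := by
    intro t ht
    have hconst : ∀ s, W (s, t) = W (0, t) := by
      rcases ht with rfl | rfl
      · intro s; rw [Ws0, Ws0]
      · intro s; rw [Wsl, Wsl]
    exact phase_unique (w := fun s => W (s, t)) (φ₁ := fun s => Φ (s, t))
      (φ₂ := fun s => Φ (0, t)) ⟨hΦ.1.comp (by fun_prop), fun t => hΦ.2 _⟩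
      ⟨continuous_const, fun s => by simp only [hconst s]; exact hΦ.2 _⟩ rfl (fun t => hW0 _) zero_le_one
  have hβS : ∀ t ∈ Icc 0 l, β t ∈ Sp 1 := by
    intro t ht
    rw [← (Hαβ t ht).2]
    exact HS _ (right_mem_Icc.2 zero_le_one) _ ht
  have b0 : β 0 = α 0 := by
    rw [← (Hαβ 0 z0).2, (Hend 1 (right_mem_Icc.2 zero_le_one)).1]
  have bl : β l = α l := by
    rw [← (Hαβ l zl).2, (Hend 1 (right_mem_Icc.2 zero_le_one)).2]
  have := sum_crossingSign_eq hl (w := fun t => W (1, t)) (ψ := fun t => Φ (1, t))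
    (hWc.comp (by fun_prop)) W1 (fun t => hWS _) hβS ⟨hΦ.1.comp (by fun_prop), fun t => hΦ.2 _⟩
    (by rwa [b0]) (by rwa [bl]) hC hT
  rw [this, c2 0 (by simp), c2 l (by simp), c1 0 z0, c1 l zl, Ws0, Wsl]

end HamiltonianMeanIndex

/-! ### Existence of a transversal representative -/

namespace HamiltonianMeanIndex

open Complex

/-- The symplectic matrix with antilinear part `z` whose linear part has argument `φ`: a
parametrization of the universal cover by a convex set. -/
noncomputable def ofPhase (φ : ℝ) (z : ℂ) : Mat 1 :=
  ofParts (Real.sqrt (4 + ‖z‖ ^ 2) * exp (φ * I)) z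

theorem ofPhase_mem_Sp (φ : ℝ) (z : ℂ) : ofPhase φ z ∈ Sp 1 := by
  rw [mem_Sp_one_iff, ofPhase, linPart_ofParts, antiPart_ofParts, norm_mul,
    Complex.norm_exp_ofReal_mul_I, mul_one, Complex.norm_real, Real.norm_eq_abs, sq_abs,
    Real.sq_sqrt (by positivity)]
  ring

theorem degen_ofPhase (φ : ℝ) (z : ℂ) :
    degen (ofPhase φ z) = 2 - Real.sqrt (4 + ‖z‖ ^ 2) * Real.cos φ := by
  rw [degen_eq (ofPhase_mem_Sp φ z), ofPhase, linPart_ofParts, Complex.re_ofReal_mul,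
    Complex.exp_ofReal_mul_I_re]

theorem ofPhase_antiPart {M : Mat 1} (hM : M ∈ Sp 1) {φ : ℝ}
    (h : linPart M = ‖linPart M‖ * exp (φ * I)) : ofPhase φ (antiPart M) = M := by
  rw [mem_Sp_one_iff] at hM
  rw [ofPhase, show 4 + ‖antiPart M‖ ^ 2 = ‖linPart M‖ ^ 2 by linarith,
    Real.sqrt_sq (norm_nonneg _), ← h, ofParts_linPart_antiPart]

theorem continuous_ofPhase : Continuous fun p : ℝ × ℂ => ofPhase p.1 p.2 := by
  unfold ofPhase
  exact continuous_ofParts.comp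
    (f := fun p : ℝ × ℂ => ((Real.sqrt (4 + ‖p.2‖ ^ 2) : ℂ) * exp (p.1 * I), p.2)) (by fun_prop)

theorem continuousOn_ofPhase {X : Type*} [TopologicalSpace X] {s : Set X} {f : X → ℝ} {g : X → ℂ}
    (hf : ContinuousOn f s) (hg : ContinuousOn g s) :
    ContinuousOn (fun x => ofPhase (f x) (g x)) s :=
  ContinuousOn.comp (g := fun p : ℝ × ℂ => ofPhase p.1 p.2) (f := fun x => (f x, g x)) (t := univ)
    continuous_ofPhase.continuousOn (hf.prodMk hg) (mapsTo_univ _ _)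

theorem differentiableAt_ofPhase {φ : ℝ → ℝ} {z : ℝ → ℂ} {t : ℝ} (hφ : DifferentiableAt ℝ φ t)
    (hz : DifferentiableAt ℝ z t) (i j : Fin 1 ⊕ Fin 1) :
    DifferentiableAt ℝ (fun s => ofPhase (φ s) (z s) i j) t := by
  have hs : DifferentiableAt ℝ (fun s => Real.sqrt (4 + ‖z s‖ ^ 2)) t :=
    ((hz.norm_sq ℝ).const_add 4).sqrt (by positivity)
  have hre : DifferentiableAt ℝ (fun s => (z s).re) t :=
    reCLM.differentiableAt.comp t hz
  have him : DifferentiableAt ℝ (fun s => (z s).im) t :=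
    imCLM.differentiableAt.comp t hz
  have hc := hs.mul hφ.cos
  have hsn := hs.mul hφ.sin
  rcases i with i | i <;> rcases j with j | j <;>
    simp only [ofPhase, ofParts, Matrix.fromBlocks_apply₁₁, Matrix.fromBlocks_apply₁₂,
      Matrix.fromBlocks_apply₂₁, Matrix.fromBlocks_apply₂₂, Matrix.of_apply,
      Complex.re_ofReal_mul, Complex.im_ofReal_mul, Complex.exp_ofReal_mul_I_re,
      Complex.exp_ofReal_mul_I_im]
  · exact (hc.add hre).div_const 2
  · exact (him.sub hsn).div_const 2
  · exact (hsn.add him).div_const 2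
  · exact (hc.sub hre).div_const 2

/-- Straight-line homotopy in the coordinates `(φ, z)`. -/
theorem spHomotopic_ofPhase {l : ℝ} {φ₁ φ₂ : ℝ → ℝ} {z₁ z₂ : ℝ → ℂ}
    (hφ₁ : ContinuousOn φ₁ (Icc 0 l)) (hφ₂ : ContinuousOn φ₂ (Icc 0 l))
    (hz₁ : ContinuousOn z₁ (Icc 0 l)) (hz₂ : ContinuousOn z₂ (Icc 0 l))
    (φ0 : φ₁ 0 = φ₂ 0) (φl : φ₁ l = φ₂ l) (z0 : z₁ 0 = z₂ 0) (zl : z₁ l = z₂ l) :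
    SpHomotopic l (fun t => ofPhase (φ₁ t) (z₁ t)) (fun t => ofPhase (φ₂ t) (z₂ t)) := by
  refine ⟨fun p => ofPhase ((1 - p.1) * φ₁ p.2 + p.1 * φ₂ p.2)
    ((1 - p.1 : ℝ) * z₁ p.2 + (p.1 : ℝ) * z₂ p.2), ?_, fun s _ t _ => ofPhase_mem_Sp _ _, ?_, ?_⟩
  · have hm : MapsTo (Prod.snd : ℝ × ℝ → ℝ) (Icc (0 : ℝ) 1 ×ˢ Icc 0 l) (Icc 0 l) :=
      fun p hp => hp.2
    have a1 : ContinuousOn (fun p : ℝ × ℝ => φ₁ p.2) (Icc (0 : ℝ) 1 ×ˢ Icc 0 l) :=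
      hφ₁.comp continuousOn_snd hm
    have a2 : ContinuousOn (fun p : ℝ × ℝ => φ₂ p.2) (Icc (0 : ℝ) 1 ×ˢ Icc 0 l) :=
      hφ₂.comp continuousOn_snd hm
    have a3 : ContinuousOn (fun p : ℝ × ℝ => z₁ p.2) (Icc (0 : ℝ) 1 ×ˢ Icc 0 l) :=
      hz₁.comp continuousOn_snd hm
    have a4 : ContinuousOn (fun p : ℝ × ℝ => z₂ p.2) (Icc (0 : ℝ) 1 ×ˢ Icc 0 l) :=
      hz₂.comp continuousOn_snd hm
    have c1 : Continuous fun p : ℝ × ℝ => ((1 - p.1 : ℝ) : ℂ) := by fun_prop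
    have c2 : Continuous fun p : ℝ × ℝ => ((p.1 : ℝ) : ℂ) := by fun_prop
    have b1 : ContinuousOn (fun p : ℝ × ℝ => (1 - p.1) * φ₁ p.2 + p.1 * φ₂ p.2)
        (Icc (0 : ℝ) 1 ×ˢ Icc 0 l) := by fun_prop
    have b2 : ContinuousOn (fun p : ℝ × ℝ => ((1 - p.1 : ℝ) : ℂ) * z₁ p.2 + (p.1 : ℝ) * z₂ p.2)
        (Icc (0 : ℝ) 1 ×ˢ Icc 0 l) :=
      (c1.continuousOn.mul a3).add (c2.continuousOn.mul a4)
    exact continuousOn_ofPhase b1 b2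
  · intro t _
    simp
  · intro s _
    constructor
    · simp only [φ0, z0]
      congr 1
      · ring
      · push_cast; ring
    · simp only [φl, zl]
      congr 1
      · ring
      · push_cast; ring

/-- Sard's lemma in dimension one. -/
theorem volume_image_critical_eq_zero (h : ℝ → ℝ) :
    MeasureTheory.volume (h '' {t | HasDerivAt h 0 t}) = 0 := by
  refine MeasureTheory.addHaar_image_eq_zero_of_det_fderivWithin_eq_zero MeasureTheory.volume
    (f' := fun _ => 0) (fun t ht => ?_) (fun t _ => by simp [ContinuousLinearMap.det])
  have := (show HasDerivAt h 0 t from ht).hasFDerivAt.hasFDerivWithinAt (s := {t | HasDerivAt h 0 t})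
  simpa using this

theorem exists_mem_Ioo_regular (h : ℝ → ℝ) {c₀ : ℝ} (hc₀ : 0 < c₀) :
    ∃ c ∈ Ioo 0 c₀, ∀ t, h t = -c → ¬ HasDerivAt h 0 t := by
  by_contra! hcon
  have hsub : Ioo (-c₀) 0 ⊆ h '' {t | HasDerivAt h 0 t} := by
    intro y hy
    obtain ⟨t, ht, hd⟩ := hcon (-y) ⟨by linarith [hy.2], by linarith [hy.1]⟩
    exact ⟨t, hd, by rw [ht, neg_neg]⟩
  have := MeasureTheory.measure_mono_null hsub (volume_image_critical_eq_zero h)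
  rw [Real.volume_Ioo, ENNReal.ofReal_eq_zero] at this
  linarith

theorem finite_zeros {F : ℝ → ℝ} {l : ℝ} (hF : Differentiable ℝ F)
    (h : ∀ t ∈ Icc 0 l, F t = 0 → deriv F t ≠ 0) : {t | t ∈ Icc 0 l ∧ F t = 0}.Finite := by
  by_contra hinf
  obtain ⟨t, ht, hacc⟩ := Set.Infinite.exists_accPt_of_subset_isCompact hinf isCompact_Icc
    (fun t ht => ht.1)
  have h0 : F t = 0 := by
    have hcl : IsClosed {t | F t = 0} := isClosed_eq hF.continuous continuous_const
    exact hcl.closure_subset_iff.2 (fun t ht => ht.2) hacc.clusterPt.mem_closure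
  have hne := (hF t).hasDerivAt.eventually_ne (c := 0) (h t ht h0)
  obtain ⟨s, hs1, hs2⟩ := (hne.and_frequently (accPt_iff_frequently_nhdsNE.1 hacc)).exists
  exact hs1 hs2.2

/-- Between any two values in `(0, 1]` there is a smooth path that stays in `(0, 1)` and crosses a
given smooth function transversally. -/
theorem exists_transversal_graph {f : ℝ → ℝ} (hf : Differentiable ℝ f) {l x₀ x₁ : ℝ} (hl : 0 < l)
    (h0 : x₀ ∈ Ioc 0 1) (h1 : x₁ ∈ Ioc 0 1) (f0 : f 0 ≠ x₀) (f1 : f l ≠ x₁) :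
    ∃ X : ℝ → ℝ, Differentiable ℝ X ∧ X 0 = x₀ ∧ X l = x₁ ∧ (∀ t ∈ Icc 0 l, X t ∈ Ioc 0 1) ∧
      ∀ t ∈ Icc 0 l, f t = X t → X t < 1 ∧ deriv (fun s => X s - f s) t ≠ 0 := by
  set u : ℝ → ℝ := fun t => t / l with hu
  set y : ℝ → ℝ := fun t => x₀ * (1 - u t) + x₁ * u t with hy
  set q : ℝ → ℝ := fun t => u t * (1 - u t) with hq
  have du : Differentiable ℝ u := differentiable_id.div_const l
  have dy : Differentiable ℝ y := by fun_prop
  have dq : Differentiable ℝ q := by fun_prop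
  have hq0 : ∀ t ∈ Ioo 0 l, 0 < q t := by
    intro t ht
    have a : 0 < u t := div_pos ht.1 hl
    have b : u t < 1 := (div_lt_one hl).2 ht.2
    exact mul_pos a (by linarith)
  -- Take `X = y - c q`. Inside the interval, `X = f` iff `(f - y) / q = -c`, and the crossing is
  -- transversal if `-c` is a regular value. The bound `c < x₀ + x₁` gives `X > x₀ (1 - u)² + x₁ u²
  -- > 0`.
  obtain ⟨c, hc, hreg⟩ := exists_mem_Ioo_regular (fun t => (f t - y t) / q t)
    (c₀ := x₀ + x₁) (by linarith [h0.1, h1.1])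
  have uI : ∀ t ∈ Icc 0 l, 0 ≤ u t ∧ u t ≤ 1 := fun t ht =>
    ⟨div_nonneg ht.1 hl.le, (div_le_one hl).2 ht.2⟩
  have u0 : u 0 = 0 := by simp [hu]
  have ul : u l = 1 := by simp [hu, hl.ne']
  refine ⟨fun t => y t - c * q t, by fun_prop, by simp [hy, hq, u0], by simp [hy, hq, ul],
    fun t ht => ?_, fun t ht hft => ?_⟩
  · obtain ⟨a, b⟩ := uI t ht
    have hc1 := hc.1
    have hc2 := hc.2
    have h01 := h0.1
    have h02 := h0.2
    have h11 := h1.1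
    have h12 := h1.2
    simp only [hy, hq]
    constructor
    · rcases a.eq_or_lt with e | e
      · rw [← e]; simpa using h01
      · rcases b.eq_or_lt with e' | e'
        · rw [e']; simpa using h11
        · have e1 : 0 < 1 - u t := by linarith
          have p := mul_pos e e1
          have := mul_lt_mul_of_pos_right hc2 p
          nlinarith [mul_pos h01 (mul_pos e1 e1), mul_pos h11 (mul_pos e e)]
    · nlinarith [mul_nonneg a (by linarith : 0 ≤ 1 - u t),
        mul_nonneg hc1.le (mul_nonneg a (by linarith : 0 ≤ 1 - u t))]
  · simp only at hft ⊢
    have htI : t ∈ Ioo 0 l := by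
      refine ⟨lt_of_le_of_ne ht.1 ?_, lt_of_le_of_ne ht.2 ?_⟩
      · rintro rfl
        exact f0 (by simpa [hy, hq, u0] using hft)
      · rintro rfl
        exact f1 (by simpa [hy, hq, ul] using hft)
    have hqt := hq0 t htI
    constructor
    · obtain ⟨a, b⟩ := uI t ht
      have : y t ≤ 1 := by
        simp only [hy]
        nlinarith [h0.2, h1.2]
      nlinarith [mul_pos hc.1 hqt]
    · intro hd0
      have dF : Differentiable ℝ (fun s => y s - c * q s - f s) := by fun_prop
      have hd : HasDerivAt (fun s => y s - c * q s - f s) 0 t := hd0 ▸ (dF t).hasDerivAt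
      have hF0 : y t - c * q t - f t = 0 := by linarith
      refine hreg t ?_ ?_
      · rw [div_eq_iff hqt.ne']; linarith
      · have h2 := ((hd.div (dq t).hasDerivAt hqt.ne').neg.sub_const c)
        have h3 : HasDerivAt (fun s => -((y s - c * q s - f s) / q s) - c) 0 t := by
          refine h2.congr_deriv ?_
          simp [hF0]
        refine h3.congr_of_eventuallyEq ?_
        filter_upwards [dq.continuous.continuousAt.eventually (lt_mem_nhds hqt)] with s hs
        have := hs.ne'
        field_simp
        ring

/-- Use an affine phase `ψ` and write `|w| = 2 / X`. The path is degenerate exactly where `cos ψ =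
X`, so transversality reduces to that of two graphs. -/
theorem exists_hasIntersectionNumber {α : ℝ → Mat 1} {l : ℝ} (hl : 0 < l) (hα : Continuous α)
    (hS : ∀ t, α t ∈ Sp 1) {φ : ℝ → ℝ} (hφ : IsPhase (fun t => linPart (α t)) φ)
    (h0 : degen (α 0) ≠ 0) (h1 : degen (α l) ≠ 0) : ∃ k, HasIntersectionNumber l α k := by
  have hαφ : ∀ t, ofPhase (φ t) (antiPart (α t)) = α t := fun t => ofPhase_antiPart (hS t) (hφ.2 t)
  set ψ : ℝ → ℝ := fun t => φ 0 * (1 - t / l) + φ l * (t / l) with hψ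
  have ψ0 : ψ 0 = φ 0 := by simp [hψ]
  have ψl : ψ l = φ l := by simp [hψ, hl.ne']
  have dψ : Differentiable ℝ ψ := by
    have : Differentiable ℝ fun t : ℝ => t / l := differentiable_id.div_const l
    fun_prop
  have hx : ∀ t, 2 / ‖linPart (α t)‖ ∈ Ioc (0 : ℝ) 1 := by
    intro t
    have := two_le_norm_linPart (hS t)
    exact ⟨by positivity, (div_le_one (by linarith)).2 this⟩
  have hdeg : ∀ t, degen (α t) ≠ 0 → Real.cos (φ t) ≠ 2 / ‖linPart (α t)‖ := by
    intro t ht hc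
    apply ht
    have := two_le_norm_linPart (hS t)
    rw [degen_eq (hS t), hφ.re_eq t, hc, mul_div_cancel₀ _ (by linarith), sub_self]
  obtain ⟨X, dX, X0, Xl, XI, XT⟩ := exists_transversal_graph dψ.cos hl (hx 0) (hx l)
    (by rw [ψ0]; exact hdeg 0 h0) (by rw [ψl]; exact hdeg l h1)
  set z : ℝ → ℂ := fun t => Real.sqrt ((2 / X t) ^ 2 - 4) *
    exp (((arg (antiPart (α 0)) * (1 - t / l) + arg (antiPart (α l)) * (t / l) : ℝ) : ℂ) * I) with hz
  have hnz : ∀ t ∈ Icc 0 l, Real.sqrt (4 + ‖z t‖ ^ 2) = 2 / X t := by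
    intro t ht
    obtain ⟨a, b⟩ := XI t ht
    have h2 : 2 ≤ 2 / X t := by rw [le_div_iff₀ a]; linarith
    have : ‖z t‖ = Real.sqrt ((2 / X t) ^ 2 - 4) := by
      rw [hz]
      simp only
      rw [norm_mul, Complex.norm_exp_ofReal_mul_I, mul_one, Complex.norm_real, Real.norm_eq_abs,
        abs_of_nonneg (Real.sqrt_nonneg _)]
    rw [this, Real.sq_sqrt (by nlinarith), add_sub_cancel, Real.sqrt_sq (by linarith)]
  have hanti : ∀ t, Real.sqrt ((2 / (2 / ‖linPart (α t)‖)) ^ 2 - 4) = ‖antiPart (α t)‖ := by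
    intro t
    have h1 := two_le_norm_linPart (hS t)
    have h2 := (mem_Sp_one_iff _).1 (hS t)
    rw [div_div_cancel₀ two_ne_zero, show ‖linPart (α t)‖ ^ 2 - 4 = ‖antiPart (α t)‖ ^ 2 by linarith,
      Real.sqrt_sq (norm_nonneg _)]
  have z0 : antiPart (α 0) = z 0 := by
    simp only [hz]
    rw [X0, hanti]
    simp
  have zl : antiPart (α l) = z l := by
    simp only [hz]
    rw [Xl, hanti]
    simp [hl.ne']
  have zc : ContinuousOn z (Icc 0 l) := by
    have hc : ContinuousOn (fun t => 2 / X t) (Icc 0 l) :=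
      continuousOn_const.div dX.continuous.continuousOn fun t ht => (XI t ht).1.ne'
    refine ContinuousOn.mul ?_ (Continuous.continuousOn (by fun_prop))
    exact continuous_ofReal.comp_continuousOn ((hc.pow 2).sub continuousOn_const).sqrt
  have hdegβ : ∀ t ∈ Icc 0 l,
      degen (ofPhase (ψ t) (z t)) = 2 / X t * (X t - Real.cos (ψ t)) := by
    intro t ht
    rw [degen_ofPhase, hnz t ht]
    have := (XI t ht).1
    field_simp
  have hzero : ∀ t ∈ Icc 0 l, (degen (ofPhase (ψ t) (z t)) = 0 ↔ X t - Real.cos (ψ t) = 0) := by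
    intro t ht
    rw [hdegβ t ht, mul_eq_zero, or_iff_right (div_pos two_pos (XI t ht).1).ne']
  have dF : Differentiable ℝ (fun t => X t - Real.cos (ψ t)) := dX.sub dψ.cos
  have hfin := finite_zeros dF (fun t ht hF => (XT t ht (by linarith)).2)
  refine ⟨_, h0, h1, fun t => ofPhase (ψ t) (z t), hfin.toFinset, ?_, ?_, ?_, rfl⟩
  · have := spHomotopic_ofPhase hφ.1.continuousOn dψ.continuous.continuousOn
      (continuous_antiPart.comp hα).continuousOn zc ψ0.symm ψl.symm z0 zl
    simpa only [Function.comp, hαφ] using this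
  · intro t
    rw [Set.Finite.mem_toFinset]
    constructor
    · rintro ⟨ht, h⟩
      exact ⟨ht, (hzero t ht).2 h⟩
    · rintro ⟨ht, h⟩
      exact ⟨ht, (hzero t ht).1 h⟩
  · intro t ht
    obtain ⟨ht, hF⟩ := hfin.mem_toFinset.1 ht
    obtain ⟨hX1, hd⟩ := XT t ht (by linarith)
    have hXt := (XI t ht).1
    have htI : t ∈ Ioo 0 l := by
      refine ⟨lt_of_le_of_ne ht.1 ?_, lt_of_le_of_ne ht.2 ?_⟩
      · rintro rfl
        apply h0
        rw [← hαφ 0, z0, ← ψ0]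
        exact (hzero 0 ht).2 hF
      · rintro rfl
        apply h1
        rw [← hαφ t, zl, ← ψl]
        exact (hzero t ht).2 hF
    refine ⟨differentiableAt_ofPhase (dψ t) ?_, ?_⟩
    · have hr : DifferentiableAt ℝ (fun t => Real.sqrt ((2 / X t) ^ 2 - 4)) t := by
        -- As `X < 1` at a crossing, the radicand is positive and `z` is differentiable there.
        have h2 : 2 < 2 / X t := by rw [lt_div_iff₀ hXt]; linarith
        have hdiv : DifferentiableAt ℝ (fun t => 2 / X t) t :=
          (differentiableAt_const 2).div (dX t) hXt.ne'
        exact ((hdiv.pow 2).sub_const 4).sqrt (by simp only [Pi.pow_apply]; nlinarith)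
      refine DifferentiableAt.mul (ofRealCLM.differentiableAt.comp t hr) ?_
      have hη : DifferentiableAt ℝ (fun t : ℝ => arg (antiPart (α 0)) * (1 - t / l) +
          arg (antiPart (α l)) * (t / l)) t := by
        have : Differentiable ℝ fun t : ℝ => t / l := differentiable_id.div_const l
        fun_prop
      exact ((ofRealCLM.differentiableAt.comp t hη).mul_const I).cexp
    · have e : (fun s => degen (ofPhase (ψ s) (z s))) =ᶠ[𝓝 t]
          fun s => 2 / X s * (X s - Real.cos (ψ s)) := by
        filter_upwards [Icc_mem_nhds htI.1 htI.2] with s hs using hdegβ s hs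
      have h2 := ((differentiableAt_const (2 : ℝ)).div (dX t) hXt.ne').hasDerivAt.mul
        (dF t).hasDerivAt
      rw [e.deriv_eq]
      have h3 := h2.deriv
      simp only [hF, mul_zero, zero_add] at h3
      exact h3 ▸ mul_ne_zero (div_pos two_pos hXt).ne' hd

end HamiltonianMeanIndex

/-! ### The Maslov-type index follows the phase -/

namespace HamiltonianMeanIndex

open Complex ComplexConjugate

section Index

theorem exists_eventually_floor_sub (y : ℝ) {c : ℝ} (hc : 0 < c) :
    ∃ n : ℤ, ∀ᶠ ε in 𝓝[>] (0 : ℝ), ⌊y - ε / c⌋ = n := by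
  refine ⟨⌈y⌉ - 1, ?_⟩
  have h1 : Tendsto (fun ε : ℝ => y - ε / c) (𝓝[>] 0) (𝓝[<] y) := by
    refine tendsto_nhdsWithin_iff.2 ⟨?_, ?_⟩
    · have : Tendsto (fun ε : ℝ => y - ε / c) (𝓝 0) (𝓝 (y - 0 / c)) := by
        apply Continuous.tendsto; fun_prop
      rw [zero_div, sub_zero] at this
      exact this.mono_left nhdsWithin_le_nhds
    · filter_upwards [self_mem_nhdsWithin] with ε (hε : 0 < ε)
      have : 0 < ε / c := by positivity
      show y - ε / c < y
      linarith
  exact tendsto_pure.1 ((tendsto_floor_left_pure_ceil_sub_one y).comp h1)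

/-- A small negative rotation moves every matrix off the degenerate hypersurface, to a definite
side. -/
theorem eventually_rotate_lt_or_gt (a b : ℝ) :
    (∀ᶠ ε in 𝓝[>] (0 : ℝ), a * Real.cos ε + b * Real.sin ε < 2) ∨
      ∀ᶠ ε in 𝓝[>] (0 : ℝ), 2 < a * Real.cos ε + b * Real.sin ε := by
  have hc : Continuous fun ε : ℝ => a * Real.cos ε + b * Real.sin ε := by fun_prop
  have hd : HasDerivAt (fun ε : ℝ => a * Real.cos ε + b * Real.sin ε) b 0 := by
    have := ((Real.hasDerivAt_cos 0).const_mul a).add ((Real.hasDerivAt_sin 0).const_mul b)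
    exact this.congr_deriv (by simp)
  rcases lt_trichotomy a 2 with ha | ha | ha
  · left
    refine nhdsWithin_le_nhds (hc.continuousAt.eventually (gt_mem_nhds ?_))
    simpa using ha
  · rcases lt_trichotomy b 0 with hb | hb | hb
    · left
      filter_upwards [(eventually_lt_of_hasDerivAt_pos hd.neg (neg_pos.2 hb)).2] with ε hε
      simp only [Pi.neg_apply, Real.cos_zero, Real.sin_zero] at hε
      linarith
    · left
      filter_upwards [Ioo_mem_nhdsGT Real.pi_pos] with ε hε
      have := Real.cos_lt_cos_of_nonneg_of_le_pi le_rfl hε.2.le hε.1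
      rw [Real.cos_zero] at this
      rw [ha, hb]
      linarith
    · right
      filter_upwards [(eventually_lt_of_hasDerivAt_pos hd hb).2] with ε hε
      simp only [Real.cos_zero, Real.sin_zero] at hε
      linarith
  · right
    refine nhdsWithin_le_nhds (hc.continuousAt.eventually (lt_mem_nhds ?_))
    simpa using ha

/-- The side of the hypersurface is eventually fixed, and the floor functions have limits from the
left. This holds for degenerate end points too. -/
theorem exists_eventually_phaseIndex (a b φ : ℝ) :
    ∃ k : ℤ, ∀ᶠ ε in 𝓝[>] (0 : ℝ), a * Real.cos ε + b * Real.sin ε ≠ 2 ∧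
      phaseIndex (φ - ε) (a * Real.cos ε + b * Real.sin ε) = k := by
  have hpi := Real.pi_pos
  rcases eventually_rotate_lt_or_gt a b with h1 | h1
  · obtain ⟨n, hn⟩ := exists_eventually_floor_sub (φ / (2 * Real.pi)) (c := 2 * Real.pi)
      (by positivity)
    refine ⟨2 * n + 1, ?_⟩
    filter_upwards [h1, hn] with ε e1 e2
    exact ⟨e1.ne, by rw [phaseIndex, if_neg e1.not_gt, sub_div, e2]⟩
  · obtain ⟨n, hn⟩ := exists_eventually_floor_sub (φ / (2 * Real.pi) + 1 / 2) (c := 2 * Real.pi)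
      (by positivity)
    refine ⟨2 * n, ?_⟩
    filter_upwards [h1, hn] with ε e1 e2
    exact ⟨e1.ne', by rw [phaseIndex, if_pos e1, sub_div, ← e2]; congr 2; ring⟩

variable {γ : ℝ → Mat 1} {φ : ℝ → ℝ}

theorem linPart_expJ_neg_mul_re (M : Mat 1) (ε : ℝ) :
    (linPart (expJ 1 (-ε) * M)).re =
      (linPart M).re * Real.cos ε + (linPart M).im * Real.sin ε := by
  rw [linPart_expJ_mul, Complex.mul_re, Complex.exp_ofReal_mul_I_re, Complex.exp_ofReal_mul_I_im,
    Real.cos_neg, Real.sin_neg]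
  ring

theorem isPhase_expJ_neg_mul (hφ : IsPhase (fun t => linPart (γ t)) φ) (ε : ℝ) :
    IsPhase (fun t => linPart (expJ 1 (-ε) * γ t)) (fun t => φ t - ε) := by
  refine ⟨hφ.1.sub continuous_const, fun t => ?_⟩
  simp only [linPart_expJ_mul, norm_mul, Complex.norm_exp_ofReal_mul_I, mul_one]
  conv_lhs => rw [show linPart (γ t) = _ from hφ.2 t]
  rw [mul_assoc, ← Complex.exp_add]
  congr 2
  push_cast
  ring

theorem HasMaslovIndex.unique (hφ : IsPhase (fun t => linPart (γ t)) φ) {l : ℝ} (hl : 0 < l)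
    {k k' : ℤ} (h : HasMaslovIndex γ l k) (h' : HasMaslovIndex γ l k') : k = k' := by
  obtain ⟨ε, h1, h2⟩ := (h.and h').exists
  have e1 := h1.eq_phaseIndex_sub hl (isPhase_expJ_neg_mul hφ ε)
  have e2 := h2.eq_phaseIndex_sub hl (isPhase_expJ_neg_mul hφ ε)
  linarith

theorem exists_hasMaslovIndex (hγ : Continuous γ) (hS : ∀ t, γ t ∈ Sp 1) (h0 : γ 0 = 1)
    (hφ : IsPhase (fun t => linPart (γ t)) φ) (hφ0 : φ 0 = 0) {l : ℝ} (hl : 0 < l) :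
    ∃ k, HasMaslovIndex γ l k ∧ |Real.pi * k - φ l| ≤ Real.pi + 1 := by
  have hpi := Real.pi_pos
  obtain ⟨k, hk⟩ := exists_eventually_phaseIndex (linPart (γ l)).re (linPart (γ l)).im (φ l)
  refine ⟨k, ?_, ?_⟩
  · filter_upwards [hk, Ioo_mem_nhdsGT hpi] with ε ⟨e1, e2⟩ hε
    have hS' : ∀ t, expJ 1 (-ε) * γ t ∈ Sp 1 := fun t => mul_mem_Sp (expJ_mem_Sp _) (hS t)
    have hre0 : (linPart (expJ 1 (-ε) * γ 0)).re = 2 * Real.cos ε := by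
      rw [linPart_expJ_neg_mul_re, h0]
      simp [linPart]
      left; norm_num
    have hcos : Real.cos ε < 1 := by
      simpa using Real.cos_lt_cos_of_nonneg_of_le_pi le_rfl hε.2.le hε.1
    have d0 : degen (expJ 1 (-ε) * γ 0) ≠ 0 := by
      rw [degen_eq (hS' 0), hre0]
      intro h; linarith
    have d1 : degen (expJ 1 (-ε) * γ l) ≠ 0 := by
      rw [degen_eq (hS' l), linPart_expJ_neg_mul_re]
      intro h; exact e1 (by linarith)
    obtain ⟨k', hk'⟩ := exists_hasIntersectionNumber hl (α := fun t => expJ 1 (-ε) * γ t)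
      (continuous_const.matrix_mul hγ) hS' (isPhase_expJ_neg_mul hφ ε) d0 d1
    have e3 := hk'.eq_phaseIndex_sub hl (isPhase_expJ_neg_mul hφ ε)
    -- The rotated path starts at `exp(-εJ)`, with phase `-ε` and `Re w < 2`. This value `-1`
    -- matches the normalisation `- 1` of the index, so `i₁` is the phase index of the end point.
    have e4 : phaseIndex (φ 0 - ε) (linPart (expJ 1 (-ε) * γ 0)).re = -1 := by
      have hf : ⌊(φ 0 - ε) / (2 * Real.pi)⌋ = -1 := by
        rw [Int.floor_eq_iff, hφ0]
        push_cast
        rw [le_div_iff₀ (by positivity), div_lt_iff₀ (by positivity)]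
        constructor <;> linarith [hε.1, hε.2]
      rw [phaseIndex, if_neg (by rw [hre0]; linarith), hf]
      norm_num
    simp only [linPart_expJ_neg_mul_re (γ l), e2, e4] at e3
    rw [e3] at hk'
    simpa using hk'
  · obtain ⟨ε, ⟨-, e⟩, hε⟩ := (hk.and (Ioo_mem_nhdsGT one_pos)).exists
    have := abs_pi_mul_phaseIndex_sub_le (φ l - ε)
      ((linPart (γ l)).re * Real.cos ε + (linPart (γ l)).im * Real.sin ε)
    rw [e] at this
    rw [abs_le] at this ⊢
    constructor <;> linarith [this.1, this.2, hε.1, hε.2]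

theorem maslovIndex_eq (hφ : IsPhase (fun t => linPart (γ t)) φ) {l : ℝ} (hl : 0 < l) {k : ℤ}
    (h : HasMaslovIndex γ l k) : maslovIndex γ l = k := by
  have hex : ∃ k, HasMaslovIndex γ l k := ⟨k, h⟩
  rw [maslovIndex, dif_pos hex]
  exact hex.choose_spec.unique hφ hl h

end Index

/-! ### Comparison of growth rates and the theorem -/

theorem tendsto_div_of_abs_sub_le {f g : ℝ → ℝ} {D R : ℝ} (h : ∀ t > 0, |f t - g t| ≤ D)
    (hg : Tendsto (fun t => g t / t) atTop (𝓝 R)) : Tendsto (fun t => f t / t) atTop (𝓝 R) := by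
  have h1 : Tendsto (fun t => (f t - g t) / t) atTop (𝓝 0) := by
    refine squeeze_zero_norm' ?_ ((tendsto_const_nhds (x := D)).div_atTop tendsto_id)
    filter_upwards [eventually_gt_atTop 0] with t ht
    rw [norm_div, Real.norm_eq_abs, Real.norm_eq_abs, abs_of_pos ht]
    exact div_le_div_of_nonneg_right (h t ht) ht.le
  have h2 := h1.add hg
  rw [zero_add] at h2
  refine h2.congr fun t => ?_
  rw [← add_div, sub_add_cancel]

theorem IsArgument.isPhase {z : ℝ → Fin 1 ⊕ Fin 1 → ℝ} {θ : ℝ → ℝ} (h : IsArgument z θ) :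
    IsPhase (fun t => toComplex (z t)) θ := by
  refine ⟨h.1, fun t => ?_⟩
  have h1 := h.2 t
  have hc := congrArg Real.Angle.cos h1
  have hs := congrArg Real.Angle.sin h1
  simp only [Real.Angle.cos_coe, Real.Angle.sin_coe] at hc hs
  have e : exp (θ t * I) = exp (arg (toComplex (z t)) * I) := by
    apply Complex.ext
    · rw [Complex.exp_ofReal_mul_I_re, Complex.exp_ofReal_mul_I_re]; exact hc
    · rw [Complex.exp_ofReal_mul_I_im, Complex.exp_ofReal_mul_I_im]; exact hs
  rw [e, Complex.norm_mul_exp_arg_mul_I]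

theorem IsFundamentalSolution.continuous {B γ : ℝ → Mat 1} (h : IsFundamentalSolution B γ) :
    Continuous γ :=
  continuous_matrix fun i j => continuous_iff_continuousAt.2 fun t => (h.2 t i j).continuousAt

/-- In a quasi-periodic system, every window length has a relatively dense set of almost periods
for the rotation of a solution, and so the rotation of a solution has a mean. -/
theorem IsQuasiPeriodic.exists_rotation {B : ℝ → Mat 1} (hB : IsQuasiPeriodic B) {w z ζ : ℝ → ℂ}
    (hp : IsPropagator (fun t => isoCoeff (B t)) (fun t => anisoCoeff (B t)) w z)
    (hζ : IsPairSolution (fun t => isoCoeff (B t)) (fun t => anisoCoeff (B t)) ζ ζ)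
    (h0 : ζ 0 ≠ 0) :
    ∃ (θ : ℝ → ℝ) (R : ℝ), IsPhase ζ θ ∧ Tendsto (fun t => θ t / t) atTop (𝓝 R) := by
  obtain ⟨m, S, p, q, hSc, -, -, hBS⟩ := hB
  set F : (Fin m → UnitAddCircle) → ℝ × ℂ := fun x => (isoCoeff (S x), anisoCoeff (S x)) with hF
  have hFc : Continuous F :=
    (continuous_isoCoeff.comp hSc).prodMk (continuous_anisoCoeff.comp hSc)
  have hFB : ∀ t, F (fun i => ((p i + q i * t : ℝ) : UnitAddCircle)) =
      (isoCoeff (B t), anisoCoeff (B t)) := fun t => by rw [hBS t]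
  have hBc : Continuous B := by
    have : B = fun t => S fun i => ((p i + q i * t : ℝ) : UnitAddCircle) := funext hBS
    rw [this]
    refine hSc.comp (continuous_pi fun i => ?_)
    exact (AddCircle.continuous_mk' (1 : ℝ)).comp (by fun_prop)
  obtain ⟨D, hD⟩ := (isCompact_range hFc).isBounded.exists_norm_le
  have hC : ∀ t, |isoCoeff (B t)| + ‖anisoCoeff (B t)‖ ≤ 2 * |D| + 1 := by
    intro t
    have h1 := hD _ (mem_range_self fun i => ((p i + q i * t : ℝ) : UnitAddCircle))
    rw [hFB] at h1
    have h2 := (norm_fst_le _).trans h1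
    have h3 := (norm_snd_le _).trans h1
    rw [Real.norm_eq_abs] at h2
    linarith [le_abs_self D]
  have hC0 : 0 < 2 * |D| + 1 := by positivity
  obtain ⟨θ, hθ, hLip⟩ := hζ.exists_lipschitz_phase (hp.solution_ne_zero hζ h0)
    (continuous_isoCoeff.comp hBc) (continuous_anisoCoeff.comp hBc) hC
  obtain ⟨R, hR⟩ := exists_tendsto_div (K := 3 * Real.pi / 2) hLip (fun T hT => by
    obtain ⟨ε, hε, H⟩ := exists_abs_rotation_sub_le hC0 hT.le
    -- The distance on `ℝ × ℂ` is a maximum while `H` bounds a sum of two terms, hence `ε / 2`.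
    obtain ⟨l, hl⟩ := exists_almost_period hFc p q (half_pos hε)
    refine ⟨l, fun a => ?_⟩
    obtain ⟨τ, hτ, hdist⟩ := hl a
    refine ⟨τ, hτ, H hp hC hζ h0 hθ τ fun t => ?_⟩
    have h1 := hdist t
    rw [hFB, hFB, dist_eq_norm] at h1
    have h2 := (norm_fst_le _).trans h1
    have h3 := (norm_snd_le _).trans h1
    simp only [Prod.fst_sub, Prod.snd_sub, Real.norm_eq_abs] at h2 h3
    linarith)
  exact ⟨θ, R, hθ, hR⟩

theorem meanIndex_eq_singleton {γ : ℝ → Mat 1} {a : ℝ}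
    (h : Tendsto (fun l => (maslovIndex γ l : ℝ) / l) atTop (𝓝 a)) : meanIndex γ = {a} := by
  have h1 : Tendsto (fun l : ℝ => (((maslovIndex γ l : ℝ) / l : ℝ) : EReal)) atTop
      (𝓝 (a : EReal)) := (continuous_coe_real_ereal.tendsto a).comp h
  ext x
  simp only [meanIndex, lowerMeanIndex, upperMeanIndex, h1.liminf_eq, h1.limsup_eq]
  constructor
  · rintro ⟨h2, h3⟩
    exact le_antisymm (EReal.coe_le_coe_iff.1 h3) (EReal.coe_le_coe_iff.1 h2)
  · rintro rfl
    exact ⟨le_rfl, le_rfl⟩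

end HamiltonianMeanIndex

open HamiltonianMeanIndex in
theorem theorem3p3 (B γ : ℝ → HamiltonianMeanIndex.Mat 1)
    (hB : HamiltonianMeanIndex.IsQuasiPeriodic B)
    (hγ : HamiltonianMeanIndex.IsFundamentalSolution B γ) :
    (∀ l : ℝ, 0 < l → ∃! k : ℤ, HamiltonianMeanIndex.HasMaslovIndex γ l k) ∧
      ∃ I R : ℝ, HamiltonianMeanIndex.meanIndex γ = {I} ∧
        HamiltonianMeanIndex.IsRotationNumber B R ∧ Real.pi * I = R := by
  have hpi := Real.pi_pos
  have hsymm : ∀ t, (B t).IsSymm := by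
    obtain ⟨m, S, p, q, -, hS, -, hBS⟩ := hB
    intro t
    rw [hBS t]
    exact hS _
  have hp := hγ.isPropagator hsymm
  have hS : ∀ t, γ t ∈ Sp 1 := fun t => (mem_Sp_one_iff _).2 (hp.norm_sq_sub t)
  obtain ⟨φ, hφ, hφ0⟩ := exists_phase hp.continuous_fst hp.fst_ne_zero 0 (φ₀ := 0) (by
    rw [hp.fst_zero]; simp)
  have hidx := fun {l : ℝ} (hl : 0 < l) =>
    exists_hasMaslovIndex hγ.continuous hS hγ.1 hφ hφ0 hl
  refine ⟨fun l hl => ?_, ?_⟩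
  · obtain ⟨k, hk, -⟩ := hidx hl
    exact ⟨k, hk, fun k' hk' => HasMaslovIndex.unique hφ hl hk' hk⟩
  -- The first column of `γ`, a solution with `ζ(0) = 1`. Its rotation number passes to `φ`, and
  -- from `φ` to the index and to every other solution.
  · set ζ : ℝ → ℂ := fun t => (linPart (γ t) + antiPart (γ t)) / 2 with hζdef
    have hζ : IsPairSolution (fun t => isoCoeff (B t)) (fun t => anisoCoeff (B t)) ζ ζ := by
      have key : ∀ t, HasDerivAt ζ (Complex.I * (isoCoeff (B t) * ζ t +
          anisoCoeff (B t) * starRingEnd ℂ (ζ t))) t := by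
        intro t
        refine (((hp.pair t).1.add (hp.pair t).2).div_const 2).congr_deriv ?_
        simp only [hζdef, map_div₀, map_add, Complex.conj_ofNat]
        ring
      exact fun t => ⟨key t, key t⟩
    have hζ0 : ζ 0 ≠ 0 := by
      have h1 : linPart (γ 0) = 2 := hp.fst_zero
      have h2 : antiPart (γ 0) = 0 := hp.snd_zero
      simp [hζdef, h1, h2]
    obtain ⟨θ, R, hθ, hR⟩ := hB.exists_rotation hp hζ hζ0
    have hφR : Tendsto (fun t => φ t / t) atTop (𝓝 R) := by
      refine tendsto_div_of_abs_sub_le (D := Real.pi / 2 + |θ 0|) (fun t ht => ?_) hR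
      have h1 := hp.abs_phase_sub_lt hζ hζ0 hφ hφ0 hθ ht.le
      have h2 := abs_le.1 (le_refl |θ 0|)
      rw [abs_lt] at h1
      rw [abs_le]
      constructor <;> linarith [h1.1, h1.2, h2.1, h2.2]
    refine ⟨R / Real.pi, R, ?_, ?_, by field_simp⟩
    · apply meanIndex_eq_singleton
      have h1 : Tendsto (fun l => Real.pi * (maslovIndex γ l : ℝ) / l) atTop (𝓝 R) := by
        refine tendsto_div_of_abs_sub_le (D := Real.pi + 1) (fun l hl => ?_) hφR
        obtain ⟨k, hk, hk'⟩ := hidx hl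
        rwa [maslovIndex_eq hφ hl hk]
      refine (h1.div_const Real.pi).congr fun l => ?_
      field_simp
    · intro z θz hz hz0 hθz
      have hζz := hz.isPairSolution hsymm
      have hz00 : toComplex (z 0) ≠ 0 := by
        intro h0
        apply hz0
        funext t
        have h1 := hp.solution_eq hζz t
        simp only [h0, map_zero, mul_zero, add_zero, zero_div] at h1
        have h2 := congrArg Complex.re h1
        have h3 := congrArg Complex.im h1
        funext i
        rcases i with i | i <;> fin_cases i
        · exact h2
        · exact h3
      refine tendsto_div_of_abs_sub_le (D := Real.pi / 2 + |θz 0|) (fun t ht => ?_) hφR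
      have h1 := hp.abs_phase_sub_lt hζz hz00 hφ hφ0 hθz.isPhase ht.le
      have h2 := abs_le.1 (le_refl |θz 0|)
      rw [abs_lt] at h1
      rw [abs_le]
      constructor <;> linarith [h1.1, h1.2, h2.1, h2.2]
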